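/- Let $p$ be a prime, $d\in\mathbb{N}_0$, and let $\widehat{\mathbb{Z}}_p^d\cong(\mathbb{Q}_p/\mathbb{Z}_p)^d$ be the dual group of $\mathbb{Z}_p^d$, with characters $\chi_p(\xi\cdot x)=e^{2\pi i\{\xi\cdot x\}_p}$. For $\xi\in\widehat{\mathbb{Z}}_p^d$ let $\|\xi\|_p=\max_i|\xi_i|_p$ (where $|\xi_i|_p:=0$ for the trivial class) and $\langle\xi\rangle=\max\{1,\|\xi\|_p\}$. Let $\widehat f(\xi)=\int_{\mathbb{Z}_p^d}f(x)\overline{\chi_p(\xi\cdot x)}\,dx$ with respect to the normalized Haar measure. For $s\ge 0$ let $H^s_2(\mathbb{Z}_p^d)$ be the space of $f\in L^2(\mathbb{Z}_p^d)$ with $\|f\|_{H^s_2}^2:=\sum_\xi|\langle\xi\rangle^s\widehat f(\xi)|^2<\infty$. Call $f:\mathbb{Z}_p^d\to\mathbb{C}$ smooth if it is continuous and $\sum_\xi|\langle\xi\rangle^s\widehat f(\xi)|^2<\infty$ for all $s\in\mathbb{R}$, and for smooth $f$ and $\beta\in\mathbb{N}_0$ put $D^\beta f(x)=\sum_\eta\|\eta\|_p^\beta\,\widehat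 f(\eta)\,\chi_p(\eta\cdot x)$ (with $D^0f=f$). For $m,\rho,\delta\in\mathbb{R}$, the class $\tilde S^m_{\rho,\delta}=\tilde S^m_{\rho,\delta}(\mathbb{Z}_p^d\times\widehat{\mathbb{Z}}_p^d)$ consists of all $\sigma:\mathbb{Z}_p^d\times\widehat{\mathbb{Z}}_p^d\to\mathbb{C}$ such that $\sigma(\cdot,\xi)$ is smooth for every $\xi$ and, for all $\alpha,\beta\in\mathbb{N}_0$, there is a constant $C$ with $$|D_x^\beta\sigma(x,\xi)|\le C\langle\xi\rangle^{m+\delta\beta}\quad\text{for all } x,\xi,$$ $$\bigl|D_x^\beta\bigl(\sigma(x,\xi+\eta)-\sigma(x,\xi)\bigr)\bigr|\le C\,\|\eta\|_p^\alpha\,\langle\xi\rangle^{m-\rho\alpha+\delta\beta}\quad\text{for all } x,\xi,\eta \text{ with } \|\eta\|_p<\|\xi\|_p .$$ Put $\tilde S^{-\infty}=\bigcap_{m\in\mathbb{R}}\tilde S^m_{0,0}$. For a symbol $\sigma$ let $T_\sigma f(x)=\sum_\xi\sigma(x,\xi)\widehat f(\xi)\chi_p(\xi\cdot x)$ for trigonometric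 polynomials $f\in\mathrm{Span}\{\chi_p(\xi\cdot x)\}_\xi$. A linear operator on $H^s_2$ (including $H^0_2=L^2$) is called smoothing if it agrees with $T_r$, for some $r\in\tilde S^{-\infty}$, on trigonometric polynomials. For a bounded operator $T:H^s_2\to L^2$, $s\ge0$, with inclusion $\iota:H^s_2\to L^2$, the Fredholm spectrum $\mathrm{Spec}_F(T)$ is the complement of the set of $\lambda\in\mathbb{C}$ for which there is a bounded operator $S:L^2\to H^s_2$ such that $S(T-\lambda\iota)-I$ (on $H^s_2$) and $(T-\lambda\iota)S-I$ (on $L^2$) are smoothing. **Theorem.** Let $0<\rho\le 1$. 1. If $\sigma\in\tilde S^0_{\rho,0}$, then $T_\sigma$ extends uniquely to a bounded operator on $L^2(\mathbb{Z}_p^d)$, and $$\mathrm{Spec}_F(T_\sigma)=\bigcap_{n\in\mathbb{N}_0}\overline{\bigcup_{\|\xi\|_p\ge n}\{\sigma(x,\xi):x\in\mathbb{Z}_p^d\}} .$$ 2. Let $m>0$ and let $\sigma\in\tilde S^m_{\rho,0}$ be elliptic, i.e. there are $C>0$ and $n_0\in\mathbb{N}_0$ with $|\sigma(x,\xi)|\ge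 C\langle\xi\rangle^m$ for all $x$ and all $\|\xi\|_p\ge n_0$. Then $T_\sigma$ extends uniquely to a bounded operator $H^m_2(\mathbb{Z}_p^d)\to L^2(\mathbb{Z}_p^d)$, and its Fredholm spectrum is given by the same formula. -/

import Mathlib

open MeasureTheory

noncomputable section
namespace PadicPDO

theorem norm_pow_mul_le_one (p : ℕ) [Fact p.Prime] (x : ℚ_[p]) :
    ‖(p : ℚ_[p]) ^ (-x.valuation).toNat * x‖ ≤ 1 := by
  by_cases hx : x = 0
  · simp [hx]
  · rw [norm_mul, norm_pow, Padic.norm_p, Padic.norm_eq_zpow_neg_valuation hx]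
    have hp : (1 : ℝ) < p := by exact_mod_cast (Fact.out : p.Prime).one_lt
    rw [inv_pow, ← zpow_natCast, ← zpow_neg, ← zpow_add₀ (by positivity)]
    apply zpow_le_one_of_nonpos₀ hp.le
    have := Int.self_le_toNat (-x.valuation)
    omega

/-- The `p`-adic fractional part `{x}_p`. -/
def fracPart (p : ℕ) [Fact p.Prime] (x : ℚ_[p]) : ℝ :=
  (PadicInt.appr ⟨(p : ℚ_[p]) ^ (-x.valuation).toNat * x, norm_pow_mul_le_one p x⟩
    (-x.valuation).toNat : ℝ) / (p : ℝ) ^ (-x.valuation).toNat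

theorem fracPart_spec (p : ℕ) [Fact p.Prime] (x : ℚ_[p]) :
    ∃ (a : ℤ) (k : ℕ), fracPart p x = (a : ℝ) / (p : ℝ) ^ k ∧
      ‖x - (a : ℚ_[p]) / (p : ℚ_[p]) ^ k‖ ≤ 1 := by
  set k := (-x.valuation).toNat with hk
  set y : ℤ_[p] := ⟨(p : ℚ_[p]) ^ k * x, norm_pow_mul_le_one p x⟩ with hy
  refine ⟨(y.appr k : ℤ), k, by simp [fracPart, hy, hk], ?_⟩
  have hp0 : (p : ℚ_[p]) ≠ 0 := by exact_mod_cast (Fact.out : p.Prime).ne_zero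
  obtain ⟨c, hc⟩ := Ideal.mem_span_singleton.mp (PadicInt.appr_spec k y)
  have h2 : (p : ℚ_[p]) ^ k * x - (y.appr k : ℚ_[p]) = (p : ℚ_[p]) ^ k * c := by
    have := congrArg (fun z : ℤ_[p] => (z : ℚ_[p])) hc
    simp only [PadicInt.coe_sub, PadicInt.coe_mul, PadicInt.coe_pow, PadicInt.coe_natCast] at this
    exact this
  have : x - ((y.appr k : ℤ) : ℚ_[p]) / (p : ℚ_[p]) ^ k = c := by
    field_simp
    push_cast
    linear_combination h2
  rw [this]
  exact c.2

/-- `y ↦ exp (2 π i {y}_p)`. -/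
def stdChar (p : ℕ) [Fact p.Prime] (y : ℚ_[p]) : ℂ :=
  Complex.exp (2 * Real.pi * Complex.I * (fracPart p y : ℂ))

theorem exists_int_of_norm_le (p : ℕ) [Fact p.Prime] (a : ℤ) (k : ℕ)
    (h : ‖(a : ℚ_[p]) / (p : ℚ_[p]) ^ k‖ ≤ 1) : ∃ n : ℤ, (a : ℝ) / (p : ℝ) ^ k = n := by
  have hp0 : (p : ℝ) ≠ 0 := by exact_mod_cast (Fact.out : p.Prime).ne_zero
  have hp0' : (0 : ℝ) < p := by exact_mod_cast (Fact.out : p.Prime).pos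
  have : ‖(a : ℚ_[p])‖ ≤ (p : ℝ) ^ (-k : ℤ) := by
    rw [norm_div, norm_pow, Padic.norm_p, inv_pow, div_inv_eq_mul] at h
    rw [zpow_neg, zpow_natCast, ← one_div, le_div_iff₀ (by positivity)]
    exact h
  obtain ⟨n, hn⟩ := (Padic.norm_int_le_pow_iff_dvd a k).1 this
  refine ⟨n, ?_⟩
  rw [hn]
  push_cast
  field_simp

theorem stdChar_add (p : ℕ) [Fact p.Prime] (x y : ℚ_[p]) :
    stdChar p (x + y) = stdChar p x * stdChar p y := by
  obtain ⟨a, k, ha, ha'⟩ := fracPart_spec p x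
  obtain ⟨b, l, hb, hb'⟩ := fracPart_spec p y
  obtain ⟨c, m, hc, hc'⟩ := fracPart_spec p (x + y)
  have hp0 : (p : ℝ) ≠ 0 := by exact_mod_cast (Fact.out : p.Prime).ne_zero
  have hp1 : (p : ℚ_[p]) ≠ 0 := by exact_mod_cast (Fact.out : p.Prime).ne_zero
  obtain ⟨n, hn⟩ := exists_int_of_norm_le p
    (c * p ^ (k + l) - a * p ^ (l + m) - b * p ^ (k + m)) (k + l + m) (by
      have : (((c * p ^ (k + l) - a * p ^ (l + m) - b * p ^ (k + m) : ℤ) : ℚ_[p])) /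
          (p : ℚ_[p]) ^ (k + l + m) =
          ((x - (a : ℚ_[p]) / (p : ℚ_[p]) ^ k) + (y - (b : ℚ_[p]) / (p : ℚ_[p]) ^ l)) -
          (x + y - (c : ℚ_[p]) / (p : ℚ_[p]) ^ m) := by
        push_cast
        field_simp
        ring
      rw [this]
      have hm : ∀ z, ‖z‖ ≤ 1 ↔ z ∈ PadicInt.subring p := fun z => Iff.rfl
      rw [hm] at ha' hb' hc' ⊢
      exact sub_mem (add_mem ha' hb') hc')
  have h : fracPart p (x + y) = fracPart p x + fracPart p y + n := by
    rw [ha, hb, hc, ← hn]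
    push_cast
    field_simp
    ring
  rw [stdChar, stdChar, stdChar, ← Complex.exp_add, Complex.exp_eq_exp_iff_exists_int]
  refine ⟨n, ?_⟩
  rw [h]
  push_cast
  ring

theorem stdChar_of_norm_le_one (p : ℕ) [Fact p.Prime] {x : ℚ_[p]} (hx : ‖x‖ ≤ 1) :
    stdChar p x = 1 := by
  have hv : (-x.valuation).toNat = 0 := by
    have := (Padic.norm_le_one_iff_val_nonneg x).1 hx
    omega
  have : fracPart p x = 0 := by
    simp only [fracPart, hv, PadicInt.appr]
    simp
  simp [stdChar, this]

theorem norm_stdChar (p : ℕ) [Fact p.Prime] (x : ℚ_[p]) : ‖stdChar p x‖ = 1 := by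
  have : stdChar p x = Complex.exp ((2 * Real.pi * fracPart p x : ℝ) * Complex.I) := by
    rw [stdChar]; congr 1; push_cast; ring
  rw [this, Complex.norm_exp_ofReal_mul_I]

/-- The compact group `ℤ_p^d`. -/
abbrev Zp (p : ℕ) [Fact p.Prime] (d : ℕ) : Type := Fin d → ℤ_[p]

/-- The dual group `(ℚ_p / ℤ_p)^d`. -/
abbrev ZpDual (p : ℕ) [Fact p.Prime] (d : ℕ) : Type :=
  Fin d → ℚ_[p] ⧸ (PadicInt.subring p).toAddSubgroup

theorem norm_quotient_mk (p : ℕ) [Fact p.Prime] (x : ℚ_[p]) :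
    ‖(QuotientAddGroup.mk x : ℚ_[p] ⧸ (PadicInt.subring p).toAddSubgroup)‖ =
      if ‖x‖ ≤ 1 then 0 else ‖x‖ := by
  split_ifs with h
  · have : (QuotientAddGroup.mk x : ℚ_[p] ⧸ (PadicInt.subring p).toAddSubgroup) = 0 :=
      (QuotientAddGroup.eq_zero_iff x).2 h
    rw [this, norm_zero]
  · rw [QuotientAddGroup.norm_mk]
    apply le_antisymm
    · have := Metric.infDist_le_dist_of_mem (x := x)
        (s := ((PadicInt.subring p).toAddSubgroup : Set ℚ_[p])) (zero_mem _)
      simpa using this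
    · rw [Metric.le_infDist ⟨0, zero_mem _⟩]
      intro y hy
      have hy : ‖y‖ ≤ 1 := hy
      rw [dist_eq_norm, sub_eq_add_neg, Padic.add_eq_max_of_ne]
      · exact le_max_left _ _
      · rw [norm_neg]; intro hh; rw [hh] at h; exact h hy


/-- `⟨ξ⟩ = max {1, ‖ξ‖_p}`. -/
def jap (p : ℕ) [Fact p.Prime] (d : ℕ) (ξ : ZpDual p d) : ℝ := max 1 ‖ξ‖

/-- The character `x ↦ χ_p(ξ · x) = exp (2 π i {ξ · x}_p)`. The choice of representatives is
immaterial, see `char_mk`. -/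
def char (p : ℕ) [Fact p.Prime] (d : ℕ) (ξ : ZpDual p d) (x : Zp p d) : ℂ :=
  stdChar p (∑ i, (ξ i).out * (x i : ℚ_[p]))

theorem char_mk (p : ℕ) [Fact p.Prime] (d : ℕ) (u : Fin d → ℚ_[p]) (x : Zp p d) :
    char p d (fun i => QuotientAddGroup.mk (u i)) x = stdChar p (∑ i, u i * (x i : ℚ_[p])) := by
  have h1 : ∀ i, ‖(QuotientAddGroup.mk (u i) :
      ℚ_[p] ⧸ (PadicInt.subring p).toAddSubgroup).out - u i‖ ≤ 1 := by
    intro i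
    obtain ⟨z, hz⟩ := QuotientAddGroup.mk_out_eq_add (PadicInt.subring p).toAddSubgroup (u i)
    rw [hz, add_sub_cancel_left]
    exact z.2
  have h2 : ‖∑ i, ((QuotientAddGroup.mk (u i) :
      ℚ_[p] ⧸ (PadicInt.subring p).toAddSubgroup).out - u i) * (x i : ℚ_[p])‖ ≤ 1 := by
    change _ ∈ PadicInt.subring p
    refine sum_mem fun i _ => mul_mem (h1 i) (x i).2
  rw [char, ← one_mul (stdChar p (∑ i, u i * (x i : ℚ_[p]))), ← stdChar_of_norm_le_one p h2,
    ← stdChar_add, ← Finset.sum_add_distrib]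
  congr 1
  exact Finset.sum_congr rfl fun i _ => by ring

theorem continuous_stdChar (p : ℕ) [Fact p.Prime] : Continuous (stdChar p) := by
  refine IsLocallyConstant.continuous ?_
  rw [IsLocallyConstant.iff_eventually_eq]
  intro x
  filter_upwards [Metric.closedBall_mem_nhds x one_pos] with y hy
  have : ‖y - x‖ ≤ 1 := by rwa [← dist_eq_norm]
  rw [← sub_add_cancel y x, stdChar_add, stdChar_of_norm_le_one p this, one_mul]

theorem continuous_char (p : ℕ) [Fact p.Prime] (d : ℕ) (ξ : ZpDual p d) :
    Continuous (char p d ξ) := by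
  unfold char
  refine (continuous_stdChar p).comp ?_
  refine continuous_finsetSum _ fun i _ => continuous_const.mul ?_
  exact continuous_subtype_val.comp (continuous_apply i)

instance instMeasurableSpace (p : ℕ) [Fact p.Prime] : MeasurableSpace ℤ_[p] := borel _

instance instBorelSpace (p : ℕ) [Fact p.Prime] : BorelSpace ℤ_[p] := ⟨rfl⟩

/-- The normalized Haar measure on `ℤ_p^d`. -/
def haar (p : ℕ) [Fact p.Prime] (d : ℕ) : Measure (Zp p d) := Measure.addHaarMeasure ⊤

instance instIsProbabilityMeasure (p : ℕ) [Fact p.Prime] (d : ℕ) :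
    IsProbabilityMeasure (haar p d) :=
  ⟨Measure.addHaarMeasure_self (K₀ := (⊤ : TopologicalSpace.PositiveCompacts (Zp p d)))⟩

/-- The Hilbert space `L²(ℤ_p^d)`. -/
abbrev L2 (p : ℕ) [Fact p.Prime] (d : ℕ) : Type := Lp ℂ 2 (haar p d)

/-- The Fourier transform on `ℤ_p^d`. -/
def fourier (p : ℕ) [Fact p.Prime] (d : ℕ) (f : Zp p d → ℂ) (ξ : ZpDual p d) : ℂ :=
  ∫ x, f x * starRingEnd ℂ (char p d ξ x) ∂haar p d

/-- The weighted Fourier coefficients `⟨ξ⟩^s f̂(ξ)`, that is, those of `J_s f`. -/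
def besselCoeff (p : ℕ) [Fact p.Prime] (d : ℕ) (s : ℝ) (f : Zp p d → ℂ) (ξ : ZpDual p d) : ℂ :=
  (jap p d ξ ^ s : ℝ) * fourier p d f ξ

theorem integrable_mul_char (p : ℕ) [Fact p.Prime] (d : ℕ) (f : L2 p d) (ξ : ZpDual p d) :
    Integrable (fun x => f x * starRingEnd ℂ (char p d ξ x)) (haar p d) := by
  have hf : Integrable f (haar p d) := (Lp.memLp f).integrable one_le_two
  refine hf.mul_bdd (c := 1) ?_ (Filter.Eventually.of_forall fun x => ?_)
  · exact (Complex.continuous_conj.comp (continuous_char p d ξ)).aestronglyMeasurable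
  · rw [RCLike.norm_conj]
    exact (norm_stdChar p _).le

theorem besselCoeff_add (p : ℕ) [Fact p.Prime] (d : ℕ) (s : ℝ) (f g : L2 p d) :
    besselCoeff p d s (f + g : L2 p d) = besselCoeff p d s f + besselCoeff p d s g := by
  funext ξ
  simp only [besselCoeff, fourier, Pi.add_apply]
  rw [← mul_add, ← integral_add (integrable_mul_char p d f ξ) (integrable_mul_char p d g ξ)]
  congr 1
  refine integral_congr_ae ?_
  filter_upwards [Lp.coeFn_add f g] with x hx
  rw [hx, Pi.add_apply, add_mul]

theorem besselCoeff_smul (p : ℕ) [Fact p.Prime] (d : ℕ) (s : ℝ) (c : ℂ) (f : L2 p d) :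
    besselCoeff p d s (c • f : L2 p d) = c • besselCoeff p d s f := by
  funext ξ
  simp only [besselCoeff, fourier, Pi.smul_apply, smul_eq_mul]
  rw [mul_left_comm, ← integral_const_mul c]
  congr 1
  refine integral_congr_ae ?_
  filter_upwards [Lp.coeFn_smul c f] with x hx
  rw [hx, Pi.smul_apply, smul_eq_mul, mul_assoc]

/-- The `L²`-functions `f` with `J_s f ∈ L²`, i.e. with `⟨ξ⟩^s f̂(ξ)` square-summable. -/
def sobolevSubmodule (p : ℕ) [Fact p.Prime] (d : ℕ) (s : ℝ) : Submodule ℂ (L2 p d) where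
  carrier := {f | Memℓp (besselCoeff p d s f) 2}
  add_mem' {f g} hf hg := by
    simp only [Set.mem_ofPred_eq] at *
    rw [besselCoeff_add]
    exact hf.add hg
  zero_mem' := by
    have : besselCoeff p d s (0 : L2 p d) = 0 := by
      have := besselCoeff_smul p d s 0 0
      rwa [zero_smul, zero_smul] at this
    simp only [Set.mem_ofPred_eq]
    rw [this]
    exact zero_memℓp
  smul_mem' c f hf := by
    simp only [Set.mem_ofPred_eq] at *
    rw [besselCoeff_smul]
    exact hf.const_smul c

/-- The Sobolev space `H^s_2(ℤ_p^d)` for `s ≥ 0`, realised inside `L²(ℤ_p^d)`. It carries the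
Sobolev norm `‖J_s f‖_{L²}` (below), not the norm of `L²(ℤ_p^d)`. -/
def Sobolev (p : ℕ) [Fact p.Prime] (d : ℕ) (s : ℝ) : Type := sobolevSubmodule p d s

instance instAddCommGroupSobolev (p : ℕ) [Fact p.Prime] (d : ℕ) (s : ℝ) :
    AddCommGroup (Sobolev p d s) :=
  inferInstanceAs (AddCommGroup (sobolevSubmodule p d s))

instance instModuleSobolev (p : ℕ) [Fact p.Prime] (d : ℕ) (s : ℝ) :
    Module ℂ (Sobolev p d s) :=
  inferInstanceAs (Module ℂ (sobolevSubmodule p d s))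

/-- The inclusion `H^s_2(ℤ_p^d) → L²(ℤ_p^d)`. -/
def sobolevIncl (p : ℕ) [Fact p.Prime] (d : ℕ) (s : ℝ) : Sobolev p d s →ₗ[ℂ] L2 p d :=
  (sobolevSubmodule p d s).subtype

/-- The map `f ↦ (⟨ξ⟩^s f̂(ξ))_ξ` from `H^s_2(ℤ_p^d)` to `ℓ²`. -/
def sobolevCoeff (p : ℕ) [Fact p.Prime] (d : ℕ) (s : ℝ) :
    Sobolev p d s →ₗ[ℂ] lp (fun _ : ZpDual p d => ℂ) 2 where
  toFun f := ⟨besselCoeff p d s (sobolevIncl p d s f), f.2⟩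
  map_add' _ _ := Subtype.ext (besselCoeff_add p d s _ _)
  map_smul' c _ := Subtype.ext (besselCoeff_smul p d s c _)

/-- The Sobolev norm `‖f‖_{H^s_2} = ‖J_s f‖_{L²} = (∑ |⟨ξ⟩^s f̂(ξ)|²)^{1/2}`. -/
instance instSeminormedSobolev (p : ℕ) [Fact p.Prime] (d : ℕ) (s : ℝ) :
    SeminormedAddCommGroup (Sobolev p d s) :=
  SeminormedAddCommGroup.induced _ _ (sobolevCoeff p d s)

instance instNormedSpaceSobolev (p : ℕ) [Fact p.Prime] (d : ℕ) (s : ℝ) :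
    NormedSpace ℂ (Sobolev p d s) :=
  NormedSpace.induced _ _ _ (sobolevCoeff p d s)

/-- `f ∈ C^∞(ℤ_p^d) = ⋂ₛ H^s_2(ℤ_p^d)`, where `f` is the continuous representative of its class. -/
def IsSmooth (p : ℕ) [Fact p.Prime] (d : ℕ) (f : Zp p d → ℂ) : Prop :=
  Continuous f ∧ ∀ s : ℝ, Memℓp (besselCoeff p d s f) 2

/-- The Vladimirov operator `D^β f(x) = ∑_η ‖η‖_p^β f̂(η) χ_p(η · x)` (with `‖η‖_p^0 = 1`). -/
def vladimirov (p : ℕ) [Fact p.Prime] (d : ℕ) (β : ℕ) (f : Zp p d → ℂ) (x : Zp p d) : ℂ :=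
  ∑' η : ZpDual p d, (‖η‖ ^ β : ℝ) * fourier p d f η * char p d η x

/-- The Hörmander class `S̃^m_{ρ,δ}(ℤ_p^d × ℤ̂_p^d)`: symbols smooth in `x` with
`|D_x^β σ(x,ξ)| ≤ C ⟨ξ⟩^(m + δβ)` and
`|D_x^β (σ(x,ξ+η) - σ(x,ξ))| ≤ C ‖η‖^α ⟨ξ⟩^(m - ρα + δβ)`, the latter for `‖η‖ < ‖ξ‖`. For `m ≥ 0`,
`0 ≤ ρ ≤ 1` and `δ ≥ 0`, the estimates for `‖η‖ = ‖ξ‖` follow from the first bound; for `m = 0` and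
`δ = 0` they follow for all `η`. -/
structure IsSymbol (p : ℕ) [Fact p.Prime] (d : ℕ) (m ρ δ : ℝ) (σ : Zp p d → ZpDual p d → ℂ) :
    Prop where
  smooth : ∀ ξ, IsSmooth p d (fun x => σ x ξ)
  size : ∀ β : ℕ, ∃ C : ℝ, ∀ x ξ,
    ‖vladimirov p d β (fun y => σ y ξ) x‖ ≤ C * jap p d ξ ^ (m + δ * β)
  diff : ∀ α β : ℕ, ∃ C : ℝ, ∀ x ξ η, ‖η‖ < ‖ξ‖ →
    ‖vladimirov p d β (fun y => σ y (ξ + η) - σ y ξ) x‖ ≤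
      C * ‖η‖ ^ α * jap p d ξ ^ (m - ρ * α + δ * β)

/-- The class `S̃^{-∞}(ℤ_p^d × ℤ̂_p^d) = ⋂ₘ S̃^m_{0,0}(ℤ_p^d × ℤ̂_p^d)`. -/
def IsSmoothingSymbol (p : ℕ) [Fact p.Prime] (d : ℕ) (σ : Zp p d → ZpDual p d → ℂ) : Prop :=
  ∀ m : ℝ, IsSymbol p d m 0 0 σ

/-- A symbol `σ` is elliptic of order `m` if `|σ(x,ξ)| ≥ C ⟨ξ⟩^m` for all large `‖ξ‖_p`. -/
def IsElliptic (p : ℕ) [Fact p.Prime] (d : ℕ) (m : ℝ) (σ : Zp p d → ZpDual p d → ℂ) : Prop :=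
  ∃ C > 0, ∃ n : ℕ, ∀ x ξ, (n : ℝ) ≤ ‖ξ‖ → C * jap p d ξ ^ m ≤ ‖σ x ξ‖

/-- `T_σ f(x) = ∑_ξ σ(x,ξ) f̂(ξ) χ_p(ξ · x)`. -/
def pseudoOp (p : ℕ) [Fact p.Prime] (d : ℕ) (σ : Zp p d → ZpDual p d → ℂ) (f : Zp p d → ℂ)
    (x : Zp p d) : ℂ :=
  ∑' ξ : ZpDual p d, σ x ξ * fourier p d f ξ * char p d ξ x

/-- The space `Span {χ_p(ξ · x)}_ξ` of trigonometric polynomials. -/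
def trigPoly (p : ℕ) [Fact p.Prime] (d : ℕ) : Submodule ℂ (Zp p d → ℂ) :=
  Submodule.span ℂ (Set.range (char p d))

/-- Let `E` and `F` be spaces of functions, included into `L²(ℤ_p^d)` through `ι` and `κ`.
The operator `A : E → F` is (the extension of) the pseudo-differential operator with symbol `σ`:
it agrees with `T_σ` on all trigonometric polynomials. -/
def HasSymbol (p : ℕ) [Fact p.Prime] (d : ℕ) {E F : Type*} [AddCommGroup E] [Module ℂ E]
    [AddCommGroup F] [Module ℂ F] (ι : E →ₗ[ℂ] L2 p d) (κ : F →ₗ[ℂ] L2 p d)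
    (A : E →ₗ[ℂ] F) (σ : Zp p d → ZpDual p d → ℂ) : Prop :=
  ∀ (f : E) (g : Zp p d → ℂ), g ∈ trigPoly p d → ι f =ᵐ[haar p d] g →
    κ (A f) =ᵐ[haar p d] pseudoOp p d σ g

/-- `R : E → E` belongs to `Op(S̃^{-∞})`. -/
def IsSmoothing (p : ℕ) [Fact p.Prime] (d : ℕ) {E : Type*} [AddCommGroup E] [Module ℂ E]
    (ι : E →ₗ[ℂ] L2 p d) (R : E →ₗ[ℂ] E) : Prop :=
  ∃ r, IsSmoothingSymbol p d r ∧ HasSymbol p d ι ι R r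

/-- The Fredholm spectrum of a bounded operator `T : E → L²(ℤ_p^d)`, where `E` is included into
`L²(ℤ_p^d)` through `ι`: the complement of the set of `λ` for which `T - λ ι` is invertible modulo
smoothing operators, by a bounded operator `S : L²(ℤ_p^d) → E`. -/
def fredholmSpectrum (p : ℕ) [Fact p.Prime] (d : ℕ) {E : Type*} [SeminormedAddCommGroup E]
    [NormedSpace ℂ E] (ι : E →ₗ[ℂ] L2 p d) (T : E →L[ℂ] L2 p d) : Set ℂ :=
  {l | ∃ S : L2 p d →L[ℂ] E,
    IsSmoothing p d ι
      ((S : L2 p d →ₗ[ℂ] E) ∘ₗ ((T : E →ₗ[ℂ] L2 p d) - l • ι) - LinearMap.id) ∧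
    IsSmoothing p d (LinearMap.id : L2 p d →ₗ[ℂ] L2 p d)
      (((T : E →ₗ[ℂ] L2 p d) - l • ι) ∘ₗ (S : L2 p d →ₗ[ℂ] E) - LinearMap.id)}ᶜ

end PadicPDO

end

/-! With `δ = 0` and `ρ > 0` the symbolic calculus is exact modulo smoothing operators. The
difference estimates hold for every `α`, so `σ(x,ξ+η) - σ(x,ξ)` decays faster than any power of
`⟨ξ⟩` for `‖η‖ < ‖ξ‖`, at a polynomial cost in `η`. The symbol of `T_a T_b` minus `a b` is `∑_θ
b̂(θ,ξ) (a(x,ξ+θ) - a(x,ξ)) χ_θ(x)`. For `‖θ‖ < ‖ξ‖` the bracket is rapidly small, and for `‖θ‖ ≥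
‖ξ‖` the decay of `b̂` in `θ` pays for everything. Hence the product is the whole composition
formula, and if `|σ - λ| ≥ c⟨ξ⟩^m` for large `ξ`, the inverse of `σ - λ` cut off to large `ξ` is
already a two-sided parametrix, with no asymptotic expansion (`notMem_fredholmSpectrum`).

Inverting a symbol is awkward with the Vladimirov operators, which obey no Leibniz rule.
`RegularSymbol` therefore replaces `D^β` by increments under translation in `x`, which pass to
inverses through `1/u - 1/v`. `IsSymbol.regularSymbol` enters this class, `RegularSymbol.cutInv`
inverts in it, and `RegularSymbol.norm_fourier_le` recovers the decay of the Fourier coefficients.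
Operators are treated as matrices in the basis of characters. Boundedness is a sum over diagonals
(`exists_matrixOperator`), and smoothing means rapid decay of the matrix
(`isSmoothing_of_rapid_decay`).

Conversely, for order zero, let `λ` be a limit of values `σ(x₀,ξ)` with `‖ξ‖ → ∞`. Take `χ_ξ` times
the Dirichlet kernel of a small ball around `x₀`. On this packet `T_σ - λ` is small by the
regularity in `x` and `ξ`, and a smoothing remainder is small because the frequencies are large, so
no left parametrix exists (`mem_fredholmSpectrum_of_mem`). For an elliptic symbol of positive order
`|σ - λ| → ∞` for every `λ`, and both sides of the formula are empty. -/

open MeasureTheory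

noncomputable section

namespace PadicPDO

/-! ### The dual group: ultrametric norm, gap at zero, characters. -/

section Dual

variable {p : ℕ} [Fact p.Prime] {d : ℕ}

/-- A trivial value makes the fractional part an integer, and an integer in `[0,1)` is `0`. -/
theorem stdChar_eq_one_iff {x : ℚ_[p]} : stdChar p x = 1 ↔ ‖x‖ ≤ 1 := by
  refine ⟨fun h => ?_, stdChar_of_norm_le_one p⟩
  rw [stdChar, Complex.exp_eq_one_iff] at h
  obtain ⟨n, hn⟩ := h
  have hpi : (2 * Real.pi * Complex.I : ℂ) ≠ 0 := by simp [Real.pi_ne_zero, Complex.I_ne_zero]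
  have h1 : (fracPart p x : ℂ) = n := by
    apply mul_left_cancel₀ hpi
    rw [hn]; ring
  have h2 : fracPart p x = n := by exact_mod_cast h1
  have hp : (0 : ℝ) < p := by exact_mod_cast (Fact.out : p.Prime).pos
  have h3 : 0 ≤ fracPart p x := by unfold fracPart; positivity
  have h4 : fracPart p x < 1 := by
    unfold fracPart
    rw [div_lt_one (by positivity)]
    exact_mod_cast PadicInt.appr_lt _ _
  have h5 : n = 0 := by
    rw [h2] at h3 h4
    have h6 : (0 : ℤ) ≤ n := by exact_mod_cast h3
    have h7 : n < 1 := by exact_mod_cast h4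
    omega
  obtain ⟨a, k, ha, hk⟩ := fracPart_spec p x
  rw [h2, h5, Int.cast_zero] at ha
  have ha0 : (a : ℝ) = 0 := by
    rcases div_eq_zero_iff.1 ha.symm with h | h
    · exact h
    · exact absurd h (by positivity)
  have : a = 0 := by exact_mod_cast ha0
  simpa [this] using hk

theorem quot_norm_add_le (a b : ℚ_[p] ⧸ (PadicInt.subring p).toAddSubgroup) :
    ‖a + b‖ ≤ max ‖a‖ ‖b‖ := by
  induction a using QuotientAddGroup.induction_on with | _ x =>
  induction b using QuotientAddGroup.induction_on with | _ y =>
  rw [← QuotientAddGroup.mk_add, norm_quotient_mk, norm_quotient_mk, norm_quotient_mk]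
  by_cases hxy : ‖x + y‖ ≤ 1
  · rw [if_pos hxy]
    apply le_max_of_le_left
    split_ifs
    exacts [le_rfl, norm_nonneg x]
  · rw [if_neg hxy]
    rcases le_max_iff.1 (Padic.nonarchimedean x y) with h | h
    · exact le_max_of_le_left (by rwa [if_neg fun hc => hxy (h.trans hc)])
    · exact le_max_of_le_right (by rwa [if_neg fun hc => hxy (h.trans hc)])

/-- This gap makes `⟨ξ⟩ = ‖ξ‖` off the trivial class and gives `‖η‖ ^ α ≥ 1` for `η ≠ 0`. -/
theorem quot_eq_zero_or_lt (a : ℚ_[p] ⧸ (PadicInt.subring p).toAddSubgroup) :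
    a = 0 ∨ 1 < ‖a‖ := by
  induction a using QuotientAddGroup.induction_on with | _ x =>
  by_cases h : ‖x‖ ≤ 1
  · exact Or.inl ((QuotientAddGroup.eq_zero_iff x).2 h)
  · right
    rw [norm_quotient_mk, if_neg h]
    exact not_le.1 h

theorem dual_norm_add_le (a b : ZpDual p d) : ‖a + b‖ ≤ max ‖a‖ ‖b‖ := by
  refine (pi_norm_le_iff_of_nonneg (le_max_of_le_left (norm_nonneg _))).2 fun i => ?_
  exact (quot_norm_add_le (a i) (b i)).trans
    (max_le_max (norm_le_pi_norm a i) (norm_le_pi_norm b i))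

theorem dual_norm_add_eq {ξ θ : ZpDual p d} (h : ‖θ‖ < ‖ξ‖) : ‖ξ + θ‖ = ‖ξ‖ := by
  apply le_antisymm
  · exact (dual_norm_add_le ξ θ).trans (max_le le_rfl h.le)
  · by_contra! h2
    have h3 := dual_norm_add_le (ξ + θ) (-θ)
    rw [add_neg_cancel_right, norm_neg] at h3
    exact absurd h3 (not_le.2 (max_lt h2 h))

theorem dual_eq_zero_or_lt (a : ZpDual p d) : a = 0 ∨ 1 < ‖a‖ := by
  by_cases h : a = 0
  · exact Or.inl h
  · right
    obtain ⟨i, hi⟩ := Function.ne_iff.1 h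
    exact ((quot_eq_zero_or_lt (a i)).resolve_left hi).trans_le (norm_le_pi_norm a i)

theorem one_le_jap (ξ : ZpDual p d) : 1 ≤ jap p d ξ := le_max_left _ _

theorem jap_pos (ξ : ZpDual p d) : 0 < jap p d ξ := one_pos.trans_le (one_le_jap ξ)

theorem norm_le_jap (ξ : ZpDual p d) : ‖ξ‖ ≤ jap p d ξ := le_max_right _ _

theorem jap_of_ne_zero {ξ : ZpDual p d} (h : ξ ≠ 0) : jap p d ξ = ‖ξ‖ :=
  max_eq_right ((dual_eq_zero_or_lt ξ).resolve_left h).le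

theorem jap_add_le_mul (a b : ZpDual p d) : jap p d (a + b) ≤ jap p d a * jap p d b := by
  have ha := one_le_jap a
  have hb := one_le_jap b
  have h : jap p d (a + b) ≤ max (jap p d a) (jap p d b) := by
    refine max_le (le_max_of_le_left ha) ((dual_norm_add_le a b).trans ?_)
    exact max_le_max (norm_le_jap a) (norm_le_jap b)
  refine h.trans (max_le ?_ ?_) <;> nlinarith

theorem jap_add_eq {ξ θ : ZpDual p d} (h : ‖θ‖ < ‖ξ‖) : jap p d (ξ + θ) = jap p d ξ := by
  rw [jap, jap, dual_norm_add_eq h]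

theorem char_add (ξ η : ZpDual p d) (x : Zp p d) :
    char p d (ξ + η) x = char p d ξ x * char p d η x := by
  have h : ∀ ζ : ZpDual p d, ζ = fun i => QuotientAddGroup.mk (ζ i).out := fun ζ => by
    funext i; exact (QuotientAddGroup.out_eq' _).symm
  have h2 : ξ + η = fun i => QuotientAddGroup.mk ((ξ i).out + (η i).out) := by
    funext i
    rw [QuotientAddGroup.mk_add, QuotientAddGroup.out_eq', QuotientAddGroup.out_eq', Pi.add_apply]
  rw [h2, char_mk, char, char, ← stdChar_add, ← Finset.sum_add_distrib]
  simp_rw [add_mul]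

theorem char_apply_add (ξ : ZpDual p d) (x y : Zp p d) :
    char p d ξ (x + y) = char p d ξ x * char p d ξ y := by
  rw [char, char, char, ← stdChar_add, ← Finset.sum_add_distrib]
  congr 1
  refine Finset.sum_congr rfl fun i _ => ?_
  rw [Pi.add_apply, PadicInt.coe_add, mul_add]

theorem norm_char (ξ : ZpDual p d) (x : Zp p d) : ‖char p d ξ x‖ = 1 := norm_stdChar p _

theorem char_zero (x : Zp p d) : char p d 0 x = 1 := by
  have h := char_add 0 0 x
  rw [add_zero] at h
  have h0 : char p d 0 x ≠ 0 := norm_ne_zero_iff.1 (by rw [norm_char]; exact one_ne_zero)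
  exact (mul_eq_left₀ h0).1 h.symm

theorem char_apply_zero (ξ : ZpDual p d) : char p d ξ 0 = 1 := by
  have h := char_apply_add ξ 0 0
  rw [add_zero] at h
  have h0 : char p d ξ 0 ≠ 0 := norm_ne_zero_iff.1 (by rw [norm_char]; exact one_ne_zero)
  exact (mul_eq_left₀ h0).1 h.symm

theorem char_neg (ξ : ZpDual p d) (x : Zp p d) :
    char p d (-ξ) x = starRingEnd ℂ (char p d ξ x) := by
  have h := char_add (-ξ) ξ x
  rw [neg_add_cancel, char_zero] at h
  have h2 : starRingEnd ℂ (char p d ξ x) * char p d ξ x = 1 := by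
    rw [mul_comm, Complex.mul_conj, Complex.normSq_eq_norm_sq, norm_char]; norm_num
  have h0 : char p d ξ x ≠ 0 := norm_ne_zero_iff.1 (by rw [norm_char]; exact one_ne_zero)
  exact mul_right_cancel₀ h0 (h.symm.trans h2.symm)

theorem char_sub (ξ η : ZpDual p d) (x : Zp p d) :
    char p d (ξ - η) x = char p d ξ x * starRingEnd ℂ (char p d η x) := by
  rw [sub_eq_add_neg, char_add, char_neg]

theorem char_apply_nsmul (ξ : ZpDual p d) (n : ℕ) (x : Zp p d) :
    char p d ξ (n • x) = char p d ξ x ^ n := by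
  induction n with
  | zero => simp [char_apply_zero]
  | succ n ih => rw [succ_nsmul, char_apply_add, ih, pow_succ]

theorem quot_norm_out (a : ℚ_[p] ⧸ (PadicInt.subring p).toAddSubgroup) :
    ‖a‖ = if ‖a.out‖ ≤ 1 then 0 else ‖a.out‖ := by
  rw [← norm_quotient_mk, QuotientAddGroup.out_eq']

theorem char_eq_one_of_norm_mul_le {θ : ZpDual p d} {x : Zp p d} (h : ‖θ‖ * ‖x‖ ≤ 1) :
    char p d θ x = 1 := by
  apply stdChar_of_norm_le_one
  change _ ∈ PadicInt.subring p
  refine sum_mem fun i _ => ?_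
  change ‖(θ i).out * (x i : ℚ_[p])‖ ≤ 1
  rw [norm_mul]
  have hx : ‖(x i : ℚ_[p])‖ ≤ ‖x‖ := norm_le_pi_norm x i
  have hx1 : ‖(x i : ℚ_[p])‖ ≤ 1 := (x i).2
  by_cases hi : ‖(θ i).out‖ ≤ 1
  · exact mul_le_one₀ hi (norm_nonneg _) hx1
  · have h1 := norm_le_pi_norm θ i
    rw [quot_norm_out, if_neg hi] at h1
    exact (mul_le_mul h1 hx (norm_nonneg _) (norm_nonneg _)).trans h

/-- Every power `N` is allowed because a character is locally constant: the left side vanishes when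
`‖θ‖ ‖x‖ ≤ 1`, and otherwise the base on the right is at least `1`. -/
theorem norm_char_sub_one_le (θ : ZpDual p d) (x : Zp p d) (N : ℕ) :
    ‖char p d θ x - 1‖ ≤ 2 * (jap p d θ * ‖x‖) ^ N := by
  by_cases h : ‖θ‖ * ‖x‖ ≤ 1
  · rw [char_eq_one_of_norm_mul_le h, sub_self, norm_zero]
    have := jap_pos θ
    positivity
  · have h1 : 1 ≤ jap p d θ * ‖x‖ :=
      (not_le.1 h).le.trans (mul_le_mul_of_nonneg_right (norm_le_jap θ) (norm_nonneg _))
    calc ‖char p d θ x - 1‖ ≤ ‖char p d θ x‖ + ‖(1 : ℂ)‖ := norm_sub_le _ _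
      _ = 2 * 1 := by rw [norm_char, norm_one]; norm_num
      _ ≤ _ := by gcongr; exact one_le_pow₀ h1

/-- The point of `ℤ_p^d` whose only non-zero coordinate is `p ^ k` at position `i`. -/
def unitPoint (p : ℕ) [Fact p.Prime] (d : ℕ) (i : Fin d) (k : ℕ) : Zp p d :=
  Pi.single i ((p : ℤ_[p]) ^ k)

theorem norm_unitPoint (i : Fin d) (k : ℕ) : ‖unitPoint p d i k‖ = ((p : ℝ) ^ k)⁻¹ := by
  rw [unitPoint, Pi.norm_single, norm_pow, PadicInt.norm_p, inv_pow]

theorem char_unitPoint (θ : ZpDual p d) (i : Fin d) (k : ℕ) :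
    char p d θ (unitPoint p d i k) = stdChar p ((θ i).out * (p : ℚ_[p]) ^ k) := by
  rw [char, Finset.sum_eq_single i]
  · simp [unitPoint]
  · intro j _ hj
    simp [unitPoint, Pi.single_eq_of_ne hj]
  · simp

/-- If coordinate `i` attains `‖θ‖ = p ^ (k + 1)`, the point `p ^ k` in that coordinate leaves a
product of norm `p > 1`. The bound on `‖y‖` later turns regularity under small translations into
Fourier decay. -/
theorem exists_char_ne_one {θ : ZpDual p d} (h : θ ≠ 0) :
    ∃ y : Zp p d, ‖y‖ ≤ p * ‖θ‖⁻¹ ∧ char p d θ y ≠ 1 := by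
  have hp : (1 : ℝ) < p := by exact_mod_cast (Fact.out : p.Prime).one_lt
  have h1 : 1 < ‖θ‖ := (dual_eq_zero_or_lt θ).resolve_left h
  obtain ⟨i, hi⟩ : ∃ i, ‖θ‖ ≤ ‖θ i‖ := by
    by_contra! hc
    exact lt_irrefl _ ((pi_norm_lt_iff (one_pos.trans h1)).2 hc)
  have hi2 : ¬ ‖(θ i).out‖ ≤ 1 := by
    intro hc
    rw [quot_norm_out, if_pos hc] at hi
    linarith
  have hi3 : ‖θ‖ = ‖(θ i).out‖ := by
    apply le_antisymm
    · rwa [quot_norm_out, if_neg hi2] at hi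
    · have := norm_le_pi_norm θ i
      rwa [quot_norm_out, if_neg hi2] at this
  have h0 : (θ i).out ≠ 0 := by
    intro hc; rw [hc, norm_zero] at hi2; exact hi2 zero_le_one
  have hv : 0 < -(θ i).out.valuation := by
    by_contra hc
    exact hi2 ((Padic.norm_le_one_iff_val_nonneg _).2 (by omega))
  obtain ⟨k, hk⟩ : ∃ k : ℕ, -(θ i).out.valuation = k + 1 :=
    ⟨(-(θ i).out.valuation - 1).toNat, by omega⟩
  have hn : ‖θ‖ = (p : ℝ) ^ (k + 1) := by
    rw [hi3, Padic.norm_eq_zpow_neg_valuation h0, hk]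
    exact_mod_cast zpow_natCast (p : ℝ) (k + 1)
  refine ⟨unitPoint p d i k, ?_, ?_⟩
  · rw [norm_unitPoint, hn, pow_succ]
    apply le_of_eq
    field_simp
  · rw [char_unitPoint, Ne, stdChar_eq_one_iff, norm_mul, ← hi3, hn, norm_pow, Padic.norm_p,
      not_le, pow_succ, inv_pow]
    field_simp
    exact hp

theorem norm_le_of_char_eq_one {x : Zp p d} {k : ℕ}
    (h : ∀ θ : ZpDual p d, ‖θ‖ ≤ (p : ℝ) ^ k → char p d θ x = 1) : ‖x‖ ≤ ((p : ℝ) ^ k)⁻¹ := by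
  have hp : (0 : ℝ) < p := by exact_mod_cast (Fact.out : p.Prime).pos
  refine (pi_norm_le_iff_of_nonneg (by positivity)).2 fun i => ?_
  have hn : ‖((p : ℚ_[p]) ^ k)⁻¹‖ = (p : ℝ) ^ k := by
    rw [norm_inv, norm_pow, Padic.norm_p, inv_pow, inv_inv]
  -- Testing with `p ^ (-k)` in a single coordinate reads off the size of that coordinate of `x`.
  have h1 := h (fun j => QuotientAddGroup.mk
      (Pi.single (M := fun _ => ℚ_[p]) i ((p : ℚ_[p]) ^ k)⁻¹ j)) (by
    refine (pi_norm_le_iff_of_nonneg (by positivity)).2 fun j => ?_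
    rw [norm_quotient_mk]
    split_ifs with hj
    · positivity
    · by_cases hij : j = i
      · subst hij; rw [Pi.single_eq_same, hn]
      · rw [Pi.single_eq_of_ne hij, norm_zero]; positivity)
  rw [char_mk, stdChar_eq_one_iff, Finset.sum_eq_single i, Pi.single_eq_same, norm_mul, hn] at h1
  · rw [← one_div, le_div_iff₀ (by positivity), mul_comm]
    exact h1
  · intro j _ hj
    rw [Pi.single_eq_of_ne hj, zero_mul]
  · simp

end Dual

/-! ### Counting the dual group: summability of powers of `⟨ξ⟩`. -/

section Summability

variable {p : ℕ} [Fact p.Prime] {d : ℕ}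

/-- Normal form of a class of `ℚ_p / ℤ_p`, with denominator controlled by the norm; it makes the
classes countable by integers. -/
theorem quot_mk_eq_appr (x : ℚ_[p]) : ∃ (k a : ℕ), a < p ^ k ∧
    (p : ℝ) ^ k ≤ max 1 ‖(QuotientAddGroup.mk x : ℚ_[p] ⧸ (PadicInt.subring p).toAddSubgroup)‖ ∧
    (QuotientAddGroup.mk x : ℚ_[p] ⧸ (PadicInt.subring p).toAddSubgroup) =
      QuotientAddGroup.mk ((a : ℚ_[p]) / (p : ℚ_[p]) ^ k) := by
  set k := (-x.valuation).toNat with hk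
  set y : ℤ_[p] := ⟨(p : ℚ_[p]) ^ k * x, norm_pow_mul_le_one p x⟩ with hy
  have hp0 : (p : ℚ_[p]) ≠ 0 := by exact_mod_cast (Fact.out : p.Prime).ne_zero
  refine ⟨k, y.appr k, PadicInt.appr_lt _ _, ?_, ?_⟩
  · rw [norm_quotient_mk]
    split_ifs with h
    · have := (Padic.norm_le_one_iff_val_nonneg x).1 h
      have : k = 0 := by omega
      simp [this]
    · apply le_max_of_le_right
      have h0 : x ≠ 0 := by
        intro hc; rw [hc, norm_zero] at h; exact h zero_le_one
      have := mt (Padic.norm_le_one_iff_val_nonneg x).2 h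
      rw [Padic.norm_eq_zpow_neg_valuation h0, ← zpow_natCast]
      apply le_of_eq
      congr 1
      omega
  · obtain ⟨c, hc⟩ := Ideal.mem_span_singleton.mp (PadicInt.appr_spec k y)
    have h2 : (p : ℚ_[p]) ^ k * x - (y.appr k : ℚ_[p]) = (p : ℚ_[p]) ^ k * c := by
      have := congrArg (fun z : ℤ_[p] => (z : ℚ_[p])) hc
      simp only [PadicInt.coe_sub, PadicInt.coe_mul, PadicInt.coe_pow,
        PadicInt.coe_natCast] at this
      exact this
    have h3 : -x + (y.appr k : ℚ_[p]) / (p : ℚ_[p]) ^ k = -(c : ℚ_[p]) := by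
      field_simp
      linear_combination -h2
    refine QuotientAddGroup.eq.2 ?_
    rw [h3]
    exact neg_mem c.2

theorem summable_quot :
    Summable fun a : ℚ_[p] ⧸ (PadicInt.subring p).toAddSubgroup => ((max 1 ‖a‖) ^ 2)⁻¹ := by
  have key : ∀ q : ℚ_[p] ⧸ (PadicInt.subring p).toAddSubgroup, ∃ (k a : ℕ), a < p ^ k ∧
      (p : ℝ) ^ k ≤ max 1 ‖q‖ ∧ q = QuotientAddGroup.mk ((a : ℚ_[p]) / (p : ℚ_[p]) ^ k) := by
    intro q
    induction q using QuotientAddGroup.induction_on with | _ x => exact quot_mk_eq_appr x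
  choose k a ha hk hq using key
  have hp2 : 2 ≤ p := (Fact.out : p.Prime).two_le
  have hlt : ∀ m n b c : ℕ, b < p ^ m → p ^ m + b = p ^ n + c → ¬ m < n := by
    intro m n b c hb he hmn
    have h1 : p ^ (m + 1) ≤ p ^ n := Nat.pow_le_pow_right (by omega) hmn
    have h2 : p ^ m * 2 ≤ p ^ (m + 1) := by rw [pow_succ]; exact Nat.mul_le_mul_left _ hp2
    omega
  -- The code `p ^ k + a` lies in `[p ^ k, 2 p ^ k)`. These intervals are disjoint for different `k`
  -- since `p ≥ 2`, so the code determines the class, and it is at most `2 max(1, ‖q‖)`. The series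
  -- is thus dominated by `∑ 4 / n ^ 2`.
  have hinj : Function.Injective fun q => p ^ k q + a q := by
    intro q r hqr
    have hqr : p ^ k q + a q = p ^ k r + a r := hqr
    have h1 := hlt _ _ _ _ (ha q) hqr
    have h2 := hlt _ _ _ _ (ha r) hqr.symm
    have h3 : k q = k r := by omega
    rw [h3] at hqr
    have h4 : a q = a r := by omega
    rw [hq q, hq r, h3, h4]
  have hs : Summable fun n : ℕ => 4 * ((n : ℝ) ^ 2)⁻¹ :=
    (Real.summable_nat_pow_inv.2 one_lt_two).mul_left 4
  refine Summable.of_nonneg_of_le (fun _ => by positivity) (fun q => ?_) (hs.comp_injective hinj)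
  have h1 : ((p ^ k q + a q : ℕ) : ℝ) ≤ 2 * max 1 ‖q‖ := by
    have h2 : ((p ^ k q + a q : ℕ) : ℝ) ≤ 2 * (p : ℝ) ^ k q := by
      have := ha q
      exact_mod_cast (by omega : p ^ k q + a q ≤ 2 * p ^ k q)
    linarith [hk q]
  have h0 : (0 : ℝ) < ((p ^ k q + a q : ℕ) : ℝ) := by
    have : 0 < p ^ k q := by positivity
    exact_mod_cast (by omega : 0 < p ^ k q + a q)
  have hm : 0 < max 1 ‖q‖ := lt_max_of_lt_left one_pos
  simp only [Function.comp]
  rw [← div_eq_mul_inv, inv_eq_one_div, div_le_div_iff₀ (by positivity) (by positivity)]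
  nlinarith

theorem summable_pi_prod {X : Type*} {g : X → ℝ} (hg : Summable g) (h0 : ∀ x, 0 ≤ g x) (d : ℕ) :
    Summable fun x : Fin d → X => ∏ i, g (x i) := by
  classical
  refine summable_of_sum_le (c := (∑' x, g x) ^ d)
    (fun x => Finset.prod_nonneg fun i _ => h0 _) fun s => ?_
  set t : Finset X := Finset.univ.biUnion fun i => s.image fun x => x i with ht
  have hst : s ⊆ Fintype.piFinset fun _ : Fin d => t := by
    intro x hx
    refine Fintype.mem_piFinset.2 fun i => ?_
    exact Finset.mem_biUnion.2 ⟨i, Finset.mem_univ _, Finset.mem_image.2 ⟨x, hx, rfl⟩⟩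
  calc ∑ x ∈ s, ∏ i, g (x i) ≤ ∑ x ∈ Fintype.piFinset fun _ : Fin d => t, ∏ i, g (x i) :=
        Finset.sum_le_sum_of_subset_of_nonneg hst fun x _ _ => Finset.prod_nonneg fun i _ => h0 _
    _ = ∏ _i : Fin d, ∑ x ∈ t, g x := (Finset.prod_univ_sum _ _).symm
    _ = (∑ x ∈ t, g x) ^ d := by simp
    _ ≤ (∑' x, g x) ^ d := by
        gcongr
        · exact Finset.sum_nonneg fun x _ => h0 x
        · exact hg.sum_le_tsum t fun x _ => h0 x

theorem summable_jap_inv {n : ℕ} (hn : 2 * d ≤ n) :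
    Summable fun θ : ZpDual p d => (jap p d θ ^ n)⁻¹ := by
  refine Summable.of_nonneg_of_le (fun θ => by have := jap_pos θ; positivity) (fun θ => ?_)
    (summable_pi_prod (summable_quot (p := p)) (fun x => by positivity) d)
  have h1 : ∏ i, (max 1 ‖θ i‖) ^ 2 ≤ jap p d θ ^ n := by
    calc ∏ i, (max 1 ‖θ i‖) ^ 2 ≤ ∏ _i : Fin d, jap p d θ ^ 2 :=
          Finset.prod_le_prod (fun i _ => by positivity) fun i _ => by
            gcongr; exact max_le_max le_rfl (norm_le_pi_norm θ i)
      _ = jap p d θ ^ (2 * d) := by simp [pow_mul]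
      _ ≤ jap p d θ ^ n := pow_le_pow_right₀ (one_le_jap θ) hn
  rw [Finset.prod_inv_distrib]
  exact inv_anti₀ (Finset.prod_pos fun i _ => by positivity) h1

/-- The terms of a summable family tend to zero along the cofinite filter, while on this set they
stay bounded below. -/
theorem finite_norm_le (R : ℝ) : {θ : ZpDual p d | ‖θ‖ ≤ R}.Finite := by
  have h := (summable_jap_inv (p := p) (d := d) le_rfl).tendsto_cofinite_zero
  have hR : 0 < ((max 1 R) ^ (2 * d))⁻¹ := by positivity
  have h2 := h.eventually (gt_mem_nhds hR)
  rw [Filter.eventually_cofinite] at h2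
  refine h2.subset fun θ hθ => ?_
  simp only [Set.mem_ofPred_eq, not_lt] at hθ ⊢
  have := jap_pos θ
  apply inv_anti₀ (by positivity)
  gcongr
  exact max_le_max le_rfl hθ

instance instCountableZpDual : Countable (ZpDual p d) := by
  rw [← Set.countable_univ_iff]
  have h : (Set.univ : Set (ZpDual p d)) = ⋃ n : ℕ, {θ | ‖θ‖ ≤ n} :=
    (Set.iUnion_eq_univ_iff.2 fun θ => exists_nat_ge ‖θ‖).symm
  rw [h]
  exact Set.countable_iUnion fun n => (finite_norm_le _).countable

instance instDecidableEqZpDual : DecidableEq (ZpDual p d) := Classical.decEq _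

end Summability

/-! ### Fourier analysis on `ℤ_p^d`: orthonormal basis, inversion, convolution. -/

section Fourier

variable {p : ℕ} [Fact p.Prime] {d : ℕ}

instance instIsAddHaarMeasureHaar : (haar p d).IsAddHaarMeasure := by
  unfold haar; infer_instance

theorem integral_char {θ : ZpDual p d} (h : θ ≠ 0) : ∫ x, char p d θ x ∂haar p d = 0 := by
  obtain ⟨y, -, hy⟩ := exists_char_ne_one h
  have h1 : ∫ x, char p d θ (y + x) ∂haar p d = ∫ x, char p d θ x ∂haar p d :=
    integral_add_left_eq_self (fun x => char p d θ x) y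
  simp_rw [char_apply_add, integral_const_mul] at h1
  have h2 : (char p d θ y - 1) * ∫ x, char p d θ x ∂haar p d = 0 := by
    rw [sub_mul, h1, one_mul, sub_self]
  exact (mul_eq_zero.1 h2).resolve_left (sub_ne_zero.2 hy)

/-- The character of `ξ` as a continuous map. -/
def charMap (p : ℕ) [Fact p.Prime] (d : ℕ) (ξ : ZpDual p d) : C(Zp p d, ℂ) :=
  ⟨char p d ξ, continuous_char p d ξ⟩

/-- The star subalgebra of `C(ℤ_p^d, ℂ)` generated by the characters. -/
def charSubalgebra (p : ℕ) [Fact p.Prime] (d : ℕ) : StarSubalgebra ℂ C(Zp p d, ℂ) where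
  toSubalgebra := Algebra.adjoin ℂ (Set.range (charMap p d))
  star_mem' := by
    change Algebra.adjoin ℂ (Set.range (charMap p d)) ≤
      star (Algebra.adjoin ℂ (Set.range (charMap p d)))
    refine Algebra.adjoin_le ?_
    rintro - ⟨n, rfl⟩
    exact Algebra.subset_adjoin ⟨-n, ContinuousMap.ext fun x => char_neg n x⟩

theorem charSubalgebra_coe :
    Subalgebra.toSubmodule (charSubalgebra p d).toSubalgebra =
      Submodule.span ℂ (Set.range (charMap p d)) := by
  apply Algebra.adjoin_eq_span_of_subset
  refine Set.Subset.trans ?_ Submodule.subset_span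
  intro x hx
  refine Submonoid.closure_induction (fun _ => id) ⟨0, ?_⟩ ?_ hx
  · ext1 z; exact char_zero z
  · rintro - - - - ⟨m, rfl⟩ ⟨n, rfl⟩
    refine ⟨m + n, ?_⟩
    ext1 z
    exact char_add m n z

/-- A difference `x - y` on which all characters are trivial lies in every ball of radius `p ^
(-k)`. By Stone–Weierstrass the characters then span a dense subspace. -/
theorem charSubalgebra_separatesPoints : (charSubalgebra p d).SeparatesPoints := by
  intro x y hxy
  obtain ⟨θ, hθ⟩ : ∃ θ : ZpDual p d, char p d θ (x - y) ≠ 1 := by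
    by_contra! hc
    apply hxy
    rw [← sub_eq_zero, ← norm_le_zero_iff]
    have hp : (1 : ℝ) < p := by exact_mod_cast (Fact.out : p.Prime).one_lt
    have ht : Filter.Tendsto (fun k : ℕ => ((p : ℝ) ^ k)⁻¹) Filter.atTop (nhds 0) :=
      (tendsto_pow_atTop_atTop_of_one_lt hp).inv_tendsto_atTop
    exact ge_of_tendsto' ht fun k => norm_le_of_char_eq_one fun θ _ => hc θ
  refine ⟨_, ⟨charMap p d θ, Algebra.subset_adjoin ⟨θ, rfl⟩, rfl⟩, fun h => hθ ?_⟩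
  have h : char p d θ x = char p d θ y := h
  have h0 : char p d θ y ≠ 0 := norm_ne_zero_iff.1 (by rw [norm_char]; exact one_ne_zero)
  have h1 := char_apply_add θ (x - y) y
  rw [sub_add_cancel, h] at h1
  exact (mul_eq_right₀ h0).1 h1.symm

theorem span_charMap_closure_eq_top :
    (Submodule.span ℂ (Set.range (charMap p d))).topologicalClosure = ⊤ := by
  rw [← charSubalgebra_coe]
  exact congrArg (Subalgebra.toSubmodule <| StarSubalgebra.toSubalgebra ·)
    (ContinuousMap.starSubalgebra_topologicalClosure_eq_top_of_separatesPoints _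
      charSubalgebra_separatesPoints)

/-- The character of `ξ` as an element of `L²(ℤ_p^d)`. -/
def charLp (p : ℕ) [Fact p.Prime] (d : ℕ) (ξ : ZpDual p d) : L2 p d :=
  ContinuousMap.toLp 2 (haar p d) ℂ (charMap p d ξ)

theorem coeFn_charLp (ξ : ZpDual p d) : charLp p d ξ =ᵐ[haar p d] char p d ξ :=
  ContinuousMap.coeFn_toLp (haar p d) (charMap p d ξ)

theorem span_charLp_closure_eq_top :
    (Submodule.span ℂ (Set.range (charLp p d))).topologicalClosure = ⊤ := by
  convert!
    (ContinuousMap.toLp_denseRange ℂ (haar p d) ℂ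
      (ENNReal.ofNat_ne_top (n := 2))).topologicalClosure_map_submodule
      span_charMap_closure_eq_top
  rw [Submodule.map_span]
  unfold charLp
  rw [Set.range_comp']
  simp only [ContinuousLinearMap.coe_coe]

theorem integral_char_mul_conj (ξ η : ZpDual p d) :
    ∫ x, char p d ξ x * starRingEnd ℂ (char p d η x) ∂haar p d = if ξ = η then 1 else 0 := by
  simp_rw [← char_sub]
  split_ifs with h
  · simp [h, char_zero]
  · exact integral_char (sub_ne_zero.2 h)

theorem orthonormal_charLp : Orthonormal ℂ (charLp p d) := by
  rw [orthonormal_iff_ite]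
  intro i j
  rw [charLp, charLp, ContinuousMap.inner_toLp (haar p d) (charMap p d i) (charMap p d j)]
  have := integral_char_mul_conj j i
  simp only [eq_comm (a := j)] at this
  exact this

/-- The Hilbert basis of characters. -/
def charBasis (p : ℕ) [Fact p.Prime] (d : ℕ) : HilbertBasis (ZpDual p d) ℂ (L2 p d) :=
  HilbertBasis.mk orthonormal_charLp span_charLp_closure_eq_top.ge

theorem coe_charBasis : ⇑(charBasis p d) = charLp p d := HilbertBasis.coe_mk _ _

theorem charBasis_repr (f : L2 p d) (ξ : ZpDual p d) :
    (charBasis p d).repr f ξ = fourier p d f ξ := by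
  rw [(charBasis p d).repr_apply_apply f ξ, L2.inner_def, coe_charBasis]
  apply integral_congr_ae
  filter_upwards [coeFn_charLp ξ] with x hx
  rw [hx, RCLike.inner_apply]

theorem fourier_congr {f g : Zp p d → ℂ} (h : f =ᵐ[haar p d] g) (ξ : ZpDual p d) :
    fourier p d f ξ = fourier p d g ξ := by
  apply integral_congr_ae
  filter_upwards [h] with x hx
  rw [hx]

theorem L2_ext {f g : L2 p d} (h : ∀ ξ, fourier p d f ξ = fourier p d g ξ) : f = g := by
  apply (charBasis p d).repr.injective
  apply lp.ext
  funext ξ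
  rw [charBasis_repr, charBasis_repr, h]

theorem fourier_charLp (ξ η : ZpDual p d) :
    fourier p d (charLp p d ξ) η = if ξ = η then 1 else 0 := by
  rw [fourier_congr (coeFn_charLp ξ)]
  exact integral_char_mul_conj ξ η

theorem integrable_of_continuous {f : Zp p d → ℂ} (hf : Continuous f) :
    Integrable f (haar p d) :=
  hf.integrable_of_hasCompactSupport (HasCompactSupport.of_compactSpace f)

theorem integrable_continuous_mul_char {f : Zp p d → ℂ} (hf : Continuous f) (ξ : ZpDual p d) :
    Integrable (fun x => f x * starRingEnd ℂ (char p d ξ x)) (haar p d) :=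
  integrable_of_continuous (hf.mul (Complex.continuous_conj.comp (continuous_char p d ξ)))

theorem norm_fourier_le {f : Zp p d → ℂ} {C : ℝ} (hC : ∀ x, ‖f x‖ ≤ C) (ξ : ZpDual p d) :
    ‖fourier p d f ξ‖ ≤ C := by
  refine (norm_integral_le_of_norm_le_const (C := C)
    (Filter.Eventually.of_forall fun x => ?_)).trans (by simp)
  rw [norm_mul, RCLike.norm_conj, norm_char, mul_one]
  exact hC x

theorem fourier_sub {f g : Zp p d → ℂ} (hf : Continuous f) (hg : Continuous g) (ξ : ZpDual p d) :
    fourier p d (fun x => f x - g x) ξ = fourier p d f ξ - fourier p d g ξ := by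
  simp only [fourier, sub_mul]
  exact integral_sub (integrable_continuous_mul_char hf ξ) (integrable_continuous_mul_char hg ξ)

theorem fourier_mul_char (f : Zp p d → ℂ) (ξ η : ZpDual p d) :
    fourier p d (fun x => f x * char p d ξ x) η = fourier p d f (η - ξ) := by
  simp only [fourier, char_sub, map_mul, RCLike.conj_conj]
  congr 1
  funext x
  ring

theorem fourier_translate (f : Zp p d → ℂ) (h : Zp p d) (ξ : ZpDual p d) :
    fourier p d (fun x => f (x + h)) ξ = char p d ξ h * fourier p d f ξ := by
  have h1 : ∫ x, f (x + h) * starRingEnd ℂ (char p d ξ (x + h)) ∂haar p d = fourier p d f ξ :=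
    integral_add_right_eq_self (fun x => f x * starRingEnd ℂ (char p d ξ x)) h
  rw [← h1, fourier, ← integral_const_mul]
  congr 1
  funext x
  have h2 : char p d ξ h * starRingEnd ℂ (char p d ξ h) = 1 := by
    rw [Complex.mul_conj, Complex.normSq_eq_norm_sq, norm_char]; norm_num
  rw [char_apply_add, map_mul]
  linear_combination (-(f (x + h) * starRingEnd ℂ (char p d ξ x))) * h2

theorem continuous_charSeries {c : ZpDual p d → ℂ} (hc : Summable fun θ => ‖c θ‖) :
    Continuous fun x => ∑' θ, c θ * char p d θ x :=
  continuous_tsum (fun θ => continuous_const.mul (continuous_char p d θ)) hc fun θ x => by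
    rw [norm_mul, norm_char, mul_one]

theorem summable_charSeries {c : ZpDual p d → ℂ} (hc : Summable fun θ => ‖c θ‖) (x : Zp p d) :
    Summable fun θ => c θ * char p d θ x :=
  Summable.of_norm (by simpa only [norm_mul, norm_char, mul_one] using hc)

theorem fourier_charSeries {c : ZpDual p d → ℂ} (hc : Summable fun θ => ‖c θ‖) (ξ : ZpDual p d) :
    fourier p d (fun x => ∑' θ, c θ * char p d θ x) ξ = c ξ := by
  have h1 : HasSum (fun θ => ∫ x, c θ * char p d θ x * starRingEnd ℂ (char p d ξ x) ∂haar p d)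
      (∫ x, ∑' θ, c θ * char p d θ x * starRingEnd ℂ (char p d ξ x) ∂haar p d) := by
    refine hasSum_integral_of_summable_integral_norm (fun θ => ?_) ?_
    · exact integrable_continuous_mul_char (continuous_const.mul (continuous_char p d θ)) ξ
    · simpa [norm_mul, norm_char] using hc
  simp_rw [mul_assoc, integral_const_mul, integral_char_mul_conj, ← mul_assoc, mul_ite, mul_one,
    mul_zero, tsum_mul_right] at h1
  refine h1.unique ?_
  convert! hasSum_ite_eq ξ (c ξ) using 2 with θ
  split_ifs with h
  exacts [by rw [h], rfl]

/-- A continuous function as an element of `L²(ℤ_p^d)`. -/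
def ofContinuous {f : Zp p d → ℂ} (hf : Continuous f) : L2 p d :=
  ContinuousMap.toLp 2 (haar p d) ℂ ⟨f, hf⟩

theorem coeFn_ofContinuous {f : Zp p d → ℂ} (hf : Continuous f) :
    ofContinuous hf =ᵐ[haar p d] f :=
  ContinuousMap.coeFn_toLp (haar p d) ⟨f, hf⟩

theorem continuous_ext {f g : Zp p d → ℂ} (hf : Continuous f) (hg : Continuous g)
    (h : ∀ ξ, fourier p d f ξ = fourier p d g ξ) : f = g := by
  have h1 : ofContinuous hf = ofContinuous hg := L2_ext fun ξ => by
    rw [fourier_congr (coeFn_ofContinuous hf), fourier_congr (coeFn_ofContinuous hg), h]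
  refine Continuous.ae_eq_iff_eq (haar p d) hf hg |>.1 ?_
  refine (coeFn_ofContinuous hf).symm.trans ?_
  rw [h1]
  exact coeFn_ofContinuous hg

theorem fourier_inversion {f : Zp p d → ℂ} (hf : Continuous f)
    (hs : Summable fun θ => ‖fourier p d f θ‖) (x : Zp p d) :
    ∑' θ, fourier p d f θ * char p d θ x = f x :=
  congrFun (continuous_ext (continuous_charSeries hs) hf fun ξ => fourier_charSeries hs ξ) x

theorem fourier_mul {f g : Zp p d → ℂ} (hf : Continuous f) (hg : Continuous g)
    (hs : Summable fun θ => ‖fourier p d f θ‖) (ξ : ZpDual p d) :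
    HasSum (fun θ => fourier p d f θ * fourier p d g (ξ - θ))
      (fourier p d (fun x => f x * g x) ξ) := by
  obtain ⟨C, hC⟩ : ∃ C, ∀ x, ‖g x‖ ≤ C := by
    obtain ⟨C, hC⟩ := (isCompact_range hg).isBounded.exists_norm_le
    exact ⟨C, fun x => hC _ ⟨x, rfl⟩⟩
  have hC0 : 0 ≤ C := (norm_nonneg _).trans (hC 0)
  have h1 : HasSum (fun θ => ∫ x, fourier p d f θ * char p d θ x * g x *
        starRingEnd ℂ (char p d ξ x) ∂haar p d)
      (∫ x, ∑' θ, fourier p d f θ * char p d θ x * g x *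
        starRingEnd ℂ (char p d ξ x) ∂haar p d) := by
    refine hasSum_integral_of_summable_integral_norm (fun θ => ?_) ?_
    · exact integrable_continuous_mul_char
        ((continuous_const.mul (continuous_char p d θ)).mul hg) ξ
    · simp only [norm_mul, norm_char, RCLike.norm_conj, mul_one, integral_const_mul]
      exact hs.mul_right _
  have h2 : ∀ x, ∑' θ, fourier p d f θ * char p d θ x * g x * starRingEnd ℂ (char p d ξ x) =
      f x * g x * starRingEnd ℂ (char p d ξ x) := fun x => by
    rw [tsum_mul_right, tsum_mul_right, fourier_inversion hf hs]
  simp_rw [h2] at h1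
  convert! h1 using 2 with θ
  rw [← fourier_mul_char, fourier.eq_def p d (fun x => g x * _), ← integral_const_mul]
  congr 1
  funext x
  ring

end Fourier

/-! ### Regular symbols: inversion, Fourier decay, composition. -/

section Symbols

variable {p : ℕ} [Fact p.Prime] {d : ℕ}

theorem jap_rpow_le_pow {m : ℝ} {M : ℕ} (h : m ≤ M) (ξ : ZpDual p d) :
    jap p d ξ ^ m ≤ jap p d ξ ^ M := by
  rw [← Real.rpow_natCast]
  exact Real.rpow_le_rpow_of_exponent_le (one_le_jap ξ) h

theorem jap_rpow_pos (ξ : ZpDual p d) (m : ℝ) : 0 < jap p d ξ ^ m :=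
  Real.rpow_pos_of_pos (jap_pos ξ) m

/-- Square-summability with the weight `⟨θ⟩^(N+2d)` gives boundedness, and the spare `⟨θ⟩^(-2d)` is
summable. -/
theorem IsSmooth.summable {f : Zp p d → ℂ} (hf : IsSmooth p d f) (N : ℕ) :
    Summable fun θ => jap p d θ ^ N * ‖fourier p d f θ‖ := by
  have h1 := (hf.2 (N + 2 * d : ℕ)).of_exponent_ge (le_top (a := 2))
  rw [memℓp_infty_iff] at h1
  obtain ⟨B, hB⟩ := h1
  have hB2 : ∀ θ, jap p d θ ^ (N + 2 * d) * ‖fourier p d f θ‖ ≤ B := fun θ => by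
    have := hB ⟨θ, rfl⟩
    simp only [besselCoeff] at this
    rwa [norm_mul, Complex.norm_real, Real.norm_eq_abs, abs_of_pos (jap_rpow_pos _ _),
      Real.rpow_natCast] at this
  refine Summable.of_nonneg_of_le (fun θ => ?_) (fun θ => ?_)
    ((summable_jap_inv (p := p) (d := d) le_rfl).mul_left B)
  · have := jap_pos θ
    positivity
  · have := jap_pos θ
    rw [← div_eq_mul_inv, le_div_iff₀ (by positivity)]
    refine le_trans (le_of_eq ?_) (hB2 θ)
    ring

theorem summable_of_jap_pow_mul {c : ZpDual p d → ℂ} {N : ℕ}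
    (h : Summable fun θ => jap p d θ ^ N * ‖c θ‖) : Summable fun θ => ‖c θ‖ :=
  Summable.of_nonneg_of_le (fun _ => norm_nonneg _)
    (fun θ => le_mul_of_one_le_left (norm_nonneg _) (one_le_pow₀ (one_le_jap θ))) h

theorem vladimirov_zero {f : Zp p d → ℂ} (hf : Continuous f)
    (hs : Summable fun θ => ‖fourier p d f θ‖) (x : Zp p d) : vladimirov p d 0 f x = f x := by
  simp only [vladimirov, pow_zero, Complex.ofReal_one, one_mul]
  exact fourier_inversion hf hs x

theorem summable_norm_vladimirov {c : ZpDual p d → ℂ} {β : ℕ}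
    (hs : Summable fun θ => jap p d θ ^ β * ‖c θ‖) :
    Summable fun θ => ‖((‖θ‖ ^ β : ℝ) : ℂ) * c θ‖ := by
  refine Summable.of_nonneg_of_le (fun _ => norm_nonneg _) (fun θ => ?_) hs
  rw [norm_mul, Complex.norm_real, Real.norm_eq_abs, abs_of_nonneg (by positivity)]
  gcongr
  exact norm_le_jap θ

theorem norm_pow_mul_fourier_le {f : Zp p d → ℂ} (hf : IsSmooth p d f) {β : ℕ} {C : ℝ}
    (hC : ∀ x, ‖vladimirov p d β f x‖ ≤ C) (θ : ZpDual p d) :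
    ‖θ‖ ^ β * ‖fourier p d f θ‖ ≤ C := by
  have h := norm_fourier_le hC θ
  unfold vladimirov at h
  rw [fourier_charSeries (summable_norm_vladimirov (hf.summable β)), norm_mul, Complex.norm_real,
    Real.norm_eq_abs, abs_of_nonneg (by positivity)] at h
  exact h

/-- Symbols of order `m` whose dependence on `x` is smooth in the sense of translations, and whose
differences in `ξ` are of order `-∞`. -/
structure RegularSymbol (p : ℕ) [Fact p.Prime] (d : ℕ) (m : ℝ) (a : Zp p d → ZpDual p d → ℂ) :
    Prop where
  cont : ∀ ξ, Continuous fun x => a x ξ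
  bound : ∃ C : ℝ, ∀ x ξ, ‖a x ξ‖ ≤ C * jap p d ξ ^ m
  trans : ∀ N : ℕ, ∃ C : ℝ, ∀ x h ξ, ‖a (x + h) ξ - a x ξ‖ ≤ C * ‖h‖ ^ N * jap p d ξ ^ m
  diff : ∀ N : ℕ, ∃ (C : ℝ) (A : ℕ), ∀ x ξ θ, ‖θ‖ < ‖ξ‖ →
    ‖a x (ξ + θ) - a x ξ‖ * jap p d ξ ^ N ≤ C * jap p d θ ^ A

theorem IsSymbol.norm_le {m ρ δ : ℝ} {σ : Zp p d → ZpDual p d → ℂ} (h : IsSymbol p d m ρ δ σ) :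
    ∃ C : ℝ, ∀ x ξ, ‖σ x ξ‖ ≤ C * jap p d ξ ^ m := by
  obtain ⟨C, hC⟩ := h.size 0
  refine ⟨C, fun x ξ => ?_⟩
  have := hC x ξ
  rwa [vladimirov_zero (h.smooth ξ).1 (summable_of_jap_pow_mul ((h.smooth ξ).summable 0)),
    Nat.cast_zero, mul_zero, add_zero] at this

theorem IsSymbol.regularSymbol {m ρ : ℝ} (hρ : 0 < ρ) {σ : Zp p d → ZpDual p d → ℂ}
    (h : IsSymbol p d m ρ 0 σ) : RegularSymbol p d m σ := by
  have hsum : ∀ ξ, Summable fun θ => ‖fourier p d (fun x => σ x ξ) θ‖ := fun ξ =>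
    summable_of_jap_pow_mul ((h.smooth ξ).summable 0)
  refine ⟨fun ξ => (h.smooth ξ).1, h.norm_le, fun N => ?_, fun N => ?_⟩
  · obtain ⟨C₀, hC₀⟩ := h.norm_le
    obtain ⟨C₁, hC₁⟩ := h.size (N + 2 * d)
    simp only [zero_mul, add_zero] at hC₁
    set c : ZpDual p d → ZpDual p d → ℂ := fun ξ θ => fourier p d (fun x => σ x ξ) θ with hc
    -- `D^β` with `β > 0` does not see the zero frequency, which is bounded through the sup norm of
    -- the symbol instead.
    have hcoef : ∀ ξ θ, jap p d θ ^ (N + 2 * d) * ‖c ξ θ‖ ≤ max C₀ C₁ * jap p d ξ ^ m := by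
      intro ξ θ
      have hj := (jap_rpow_pos ξ m).le
      by_cases hθ : θ = 0
      · subst hθ
        simp only [jap, norm_zero, zero_le_one, max_eq_left, one_pow, one_mul]
        exact (norm_fourier_le (fun x => hC₀ x ξ) 0).trans
          (mul_le_mul_of_nonneg_right (le_max_left _ _) hj)
      · rw [jap_of_ne_zero hθ]
        exact (norm_pow_mul_fourier_le (h.smooth ξ) (fun x => hC₁ x ξ) θ).trans
          (mul_le_mul_of_nonneg_right (le_max_right _ _) hj)
    refine ⟨2 * max C₀ C₁ * ∑' θ : ZpDual p d, (jap p d θ ^ (2 * d))⁻¹, fun x y ξ => ?_⟩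
    have h1 : HasSum (fun θ => c ξ θ * char p d θ (x + y) - c ξ θ * char p d θ x)
        (σ (x + y) ξ - σ x ξ) := by
      have e : ∀ x, HasSum (fun θ => c ξ θ * char p d θ x) (σ x ξ) := fun x => by
        rw [← fourier_inversion (h.smooth ξ).1 (hsum ξ) x]
        exact (summable_charSeries (hsum ξ) x).hasSum
      exact (e (x + y)).sub (e x)
    have h2 : HasSum (fun θ : ZpDual p d => 2 * max C₀ C₁ * ‖y‖ ^ N * jap p d ξ ^ m *
        (jap p d θ ^ (2 * d))⁻¹) (2 * max C₀ C₁ * ‖y‖ ^ N * jap p d ξ ^ m *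
          ∑' θ : ZpDual p d, (jap p d θ ^ (2 * d))⁻¹) :=
      (summable_jap_inv le_rfl).hasSum.mul_left _
    refine (h1.norm_le_of_bounded h2 fun θ => ?_).trans (le_of_eq (by ring))
    rw [char_apply_add, ← mul_assoc, ← mul_sub_one, norm_mul, norm_mul, norm_char, mul_one]
    have hj := jap_pos θ
    calc ‖c ξ θ‖ * ‖char p d θ y - 1‖ ≤ ‖c ξ θ‖ * (2 * (jap p d θ * ‖y‖) ^ N) := by
          gcongr; exact norm_char_sub_one_le θ y N
      _ = 2 * ‖y‖ ^ N * (jap p d θ ^ (N + 2 * d) * ‖c ξ θ‖) * (jap p d θ ^ (2 * d))⁻¹ := by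
          rw [mul_pow, pow_add]; field_simp
      _ ≤ 2 * ‖y‖ ^ N * (max C₀ C₁ * jap p d ξ ^ m) * (jap p d θ ^ (2 * d))⁻¹ := by
          exact mul_le_mul_of_nonneg_right
            (mul_le_mul_of_nonneg_left (hcoef ξ θ) (by positivity)) (by positivity)
      _ = _ := by ring
  -- Here `ρ > 0` is decisive: `α ≥ (m + N) / ρ` makes `⟨ξ⟩^(m - ρα + N) ≤ 1`.
  · obtain ⟨α, hα⟩ := exists_nat_ge ((m + N) / ρ)
    rw [div_le_iff₀ hρ] at hα
    obtain ⟨C, hC⟩ := h.diff α 0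
    refine ⟨|C|, α, fun x ξ θ hθ => ?_⟩
    have h1 := hC x ξ θ hθ
    have hs : Summable fun η => ‖fourier p d (fun y => σ y (ξ + θ) - σ y ξ) η‖ := by
      simp_rw [fourier_sub (h.smooth (ξ + θ)).1 (h.smooth ξ).1]
      exact Summable.of_nonneg_of_le (fun _ => norm_nonneg _) (fun _ => norm_sub_le _ _)
        ((hsum (ξ + θ)).add (hsum ξ))
    rw [vladimirov_zero (f := fun y => σ y (ξ + θ) - σ y ξ)
      ((h.smooth (ξ + θ)).1.sub (h.smooth ξ).1) hs] at h1
    have hj := jap_pos ξ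
    have h2 : jap p d ξ ^ (m - ρ * α + 0 * (0 : ℕ)) * jap p d ξ ^ N ≤ 1 := by
      rw [← Real.rpow_natCast, ← Real.rpow_add hj]
      apply Real.rpow_le_one_of_one_le_of_nonpos (one_le_jap ξ)
      nlinarith
    calc ‖σ x (ξ + θ) - σ x ξ‖ * jap p d ξ ^ N
        ≤ |C| * jap p d θ ^ α * jap p d ξ ^ (m - ρ * α + 0 * (0 : ℕ)) * jap p d ξ ^ N := by
          gcongr
          refine h1.trans ?_
          have := jap_rpow_pos ξ (m - ρ * α + 0 * (0 : ℕ))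
          have := norm_le_jap θ
          gcongr
          exact le_abs_self C
      _ = |C| * jap p d θ ^ α * (jap p d ξ ^ (m - ρ * α + 0 * (0 : ℕ)) * jap p d ξ ^ N) := by ring
      _ ≤ |C| * jap p d θ ^ α * 1 := by
          have := jap_pos θ
          gcongr
      _ = _ := mul_one _

theorem RegularSymbol.sub_const {m : ℝ} (hm : 0 ≤ m) {a : Zp p d → ZpDual p d → ℂ}
    (h : RegularSymbol p d m a) (l : ℂ) : RegularSymbol p d m fun x ξ => a x ξ - l := by
  refine ⟨fun ξ => (h.cont ξ).sub continuous_const, ?_, ?_, ?_⟩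
  · obtain ⟨C, hC⟩ := h.bound
    refine ⟨C + ‖l‖, fun x ξ => (norm_sub_le _ _).trans ?_⟩
    have := Real.one_le_rpow (one_le_jap ξ) hm
    nlinarith [hC x ξ, norm_nonneg l]
  · simpa only [sub_sub_sub_cancel_right] using h.trans
  · simpa only [sub_sub_sub_cancel_right] using h.diff

theorem norm_inv_sub_inv_le {u v : ℂ} {r : ℝ} (hr : 0 < r) (hu : r ≤ ‖u‖) (hv : r ≤ ‖v‖) :
    ‖u⁻¹ - v⁻¹‖ ≤ ‖u - v‖ * (r ^ 2)⁻¹ := by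
  have hu0 : u ≠ 0 := norm_pos_iff.1 (hr.trans_le hu)
  have hv0 : v ≠ 0 := norm_pos_iff.1 (hr.trans_le hv)
  rw [inv_sub_inv hu0 hv0, norm_div, norm_mul, norm_sub_rev, div_eq_mul_inv]
  gcongr
  rw [sq]
  gcongr

/-- The inverse of a symbol, cut off to `‖ξ‖ ≥ n`. -/
def cutInv (p : ℕ) [Fact p.Prime] (d : ℕ) (n : ℕ) (a : Zp p d → ZpDual p d → ℂ)
    (x : Zp p d) (ξ : ZpDual p d) : ℂ :=
  if (n : ℝ) ≤ ‖ξ‖ then (a x ξ)⁻¹ else 0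

theorem RegularSymbol.cutInv {m : ℝ} (hm : 0 ≤ m) {a : Zp p d → ZpDual p d → ℂ}
    (h : RegularSymbol p d m a) {c : ℝ} (hc : 0 < c) {n : ℕ}
    (hell : ∀ x ξ, (n : ℝ) ≤ ‖ξ‖ → c * jap p d ξ ^ m ≤ ‖a x ξ‖) :
    RegularSymbol p d (-m) (cutInv p d n a) := by
  have hpos : ∀ ξ : ZpDual p d, 0 < c * jap p d ξ ^ m := fun ξ => mul_pos hc (jap_rpow_pos ξ m)
  refine ⟨fun ξ => ?_, ⟨c⁻¹, fun x ξ => ?_⟩, fun N => ?_, fun N => ?_⟩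
  · simp only [PadicPDO.cutInv]
    split_ifs with hξ
    · exact (h.cont ξ).inv₀ fun x => norm_pos_iff.1 ((hpos ξ).trans_le (hell x ξ hξ))
    · exact continuous_const
  · simp only [PadicPDO.cutInv]
    split_ifs with hξ
    · rw [norm_inv, Real.rpow_neg (jap_pos ξ).le, ← mul_inv]
      exact inv_anti₀ (hpos ξ) (hell x ξ hξ)
    · rw [norm_zero]
      have := jap_rpow_pos ξ (-m)
      positivity
  · obtain ⟨C, hC⟩ := h.trans N
    refine ⟨|C| * (c ^ 2)⁻¹, fun x y ξ => ?_⟩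
    simp only [PadicPDO.cutInv]
    have hj := jap_rpow_pos ξ (-m)
    split_ifs with hξ
    · refine (norm_inv_sub_inv_le (hpos ξ) (hell _ ξ hξ) (hell _ ξ hξ)).trans ?_
      have hj := jap_rpow_pos ξ m
      calc ‖a (x + y) ξ - a x ξ‖ * ((c * jap p d ξ ^ m) ^ 2)⁻¹
          ≤ |C| * ‖y‖ ^ N * jap p d ξ ^ m * ((c * jap p d ξ ^ m) ^ 2)⁻¹ := by
            gcongr
            refine (hC x y ξ).trans ?_
            gcongr
            exact le_abs_self C
        _ = _ := by
            rw [Real.rpow_neg (jap_pos ξ).le]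
            field_simp
    · rw [sub_self, norm_zero]
      positivity
  · obtain ⟨C, A, hC⟩ := h.diff N
    refine ⟨|C| * (c ^ 2)⁻¹, A, fun x ξ θ hθ => ?_⟩
    -- For `‖θ‖ < ‖ξ‖` the norms of `ξ + θ` and `ξ` agree, so both points lie on the same side of
    -- the cutoff and the sharp cutoff costs nothing.
    simp only [PadicPDO.cutInv, dual_norm_add_eq hθ]
    have hj := jap_pos ξ
    have hj2 := jap_pos θ
    split_ifs with hξ
    · have h1 : ∀ ζ : ZpDual p d, (n : ℝ) ≤ ‖ζ‖ → c ≤ ‖a x ζ‖ := fun ζ hζ =>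
        (le_mul_of_one_le_right hc.le (Real.one_le_rpow (one_le_jap ζ) hm)).trans (hell x ζ hζ)
      calc ‖(a x (ξ + θ))⁻¹ - (a x ξ)⁻¹‖ * jap p d ξ ^ N
          ≤ ‖a x (ξ + θ) - a x ξ‖ * (c ^ 2)⁻¹ * jap p d ξ ^ N := by
            gcongr
            exact norm_inv_sub_inv_le hc (h1 _ (by rwa [dual_norm_add_eq hθ])) (h1 _ hξ)
        _ = ‖a x (ξ + θ) - a x ξ‖ * jap p d ξ ^ N * (c ^ 2)⁻¹ := by ring
        _ ≤ |C| * jap p d θ ^ A * (c ^ 2)⁻¹ := by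
            refine mul_le_mul_of_nonneg_right ((hC x ξ θ hθ).trans ?_) (by positivity)
            gcongr
            exact le_abs_self C
        _ = _ := by ring
    · rw [sub_self, norm_zero, zero_mul]
      positivity

theorem norm_nsmul_le_norm (j : ℕ) (y : Zp p d) : ‖j • y‖ ≤ ‖y‖ := by
  refine (pi_norm_le_iff_of_nonneg (norm_nonneg _)).2 fun i => ?_
  rw [Pi.smul_apply, nsmul_eq_mul, norm_mul]
  exact (mul_le_of_le_one_left (norm_nonneg _) (PadicInt.norm_le_one _)).trans (norm_le_pi_norm y i)

theorem exists_char_pow_eq_one (θ : ZpDual p d) (y : Zp p d) :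
    ∃ n : ℕ, 0 < n ∧ char p d θ y ^ n = 1 := by
  have hp : (1 : ℝ) < p := by exact_mod_cast (Fact.out : p.Prime).one_lt
  obtain ⟨k, hk⟩ := pow_unbounded_of_one_lt ‖θ‖ hp
  refine ⟨p ^ k, pow_pos (Fact.out : p.Prime).pos k, ?_⟩
  rw [← char_apply_nsmul]
  apply char_eq_one_of_norm_mul_le
  have h1 : ‖(p ^ k) • y‖ ≤ ((p : ℝ) ^ k)⁻¹ := by
    refine (pi_norm_le_iff_of_nonneg (by positivity)).2 fun i => ?_
    rw [Pi.smul_apply, nsmul_eq_mul, norm_mul, Nat.cast_pow, norm_pow, PadicInt.norm_p, inv_pow]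
    exact mul_le_of_le_one_right (by positivity) (PadicInt.norm_le_one _)
  calc ‖θ‖ * ‖(p ^ k) • y‖ ≤ (p : ℝ) ^ k * ((p : ℝ) ^ k)⁻¹ := by gcongr
    _ = 1 := mul_inv_cancel₀ (by positivity)

/-- Choose `y` with `‖y‖ ≤ p / ‖θ‖` and `z = χ_θ(y) ≠ 1`. All multiples `j • y` are no longer than
`y`, so every `(z ^ j - 1) f̂(θ)` obeys the bound. Since `z` is a root of unity, averaging over a
full period gives `-f̂(θ)`, and no lower bound for `|z - 1|` is needed. -/
theorem norm_fourier_le_of_translate {f : Zp p d → ℂ} (hf : Continuous f) {D : ℝ} (hD : 0 ≤ D)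
    {N : ℕ} (h : ∀ x y, ‖f (x + y) - f x‖ ≤ D * ‖y‖ ^ N) {θ : ZpDual p d} (hθ : θ ≠ 0) :
    ‖fourier p d f θ‖ ≤ D * (p * ‖θ‖⁻¹) ^ N := by
  obtain ⟨y, hy, hz⟩ := exists_char_ne_one hθ
  obtain ⟨n, hn, hzn⟩ := exists_char_pow_eq_one θ y
  set z := char p d θ y with hzdef
  have h1 : ∀ j : ℕ, ‖(z ^ j - 1) * fourier p d f θ‖ ≤ D * (p * ‖θ‖⁻¹) ^ N := by
    intro j
    have e : (z ^ j - 1) * fourier p d f θ = fourier p d (fun x => f (x + j • y) - f x) θ := by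
      rw [fourier_sub (f := fun x => f (x + j • y)) (hf.comp (continuous_add_const _)) hf, fourier_translate, char_apply_nsmul]
      ring
    rw [e]
    refine norm_fourier_le (fun x => (h x (j • y)).trans ?_) θ
    gcongr
    exact (norm_nsmul_le_norm j y).trans hy
  have h2 : ∑ j ∈ Finset.range n, z ^ j = 0 := by
    rw [geom_sum_eq hz, hzn, sub_self, zero_div]
  have h3 : ∑ j ∈ Finset.range n, (z ^ j - 1) * fourier p d f θ = -(n * fourier p d f θ) := by
    rw [← Finset.sum_mul, Finset.sum_sub_distrib, h2]
    simp
  have h4 : (n : ℝ) * ‖fourier p d f θ‖ ≤ n * (D * (p * ‖θ‖⁻¹) ^ N) := by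
    have h5 := norm_sum_le_of_le (Finset.range n) fun j _ => h1 j
    rw [h3, norm_neg, norm_mul, Complex.norm_natCast, Finset.sum_const, Finset.card_range,
      nsmul_eq_mul] at h5
    exact h5
  exact le_of_mul_le_mul_left h4 (by exact_mod_cast hn)

theorem RegularSymbol.norm_fourier_le {m : ℝ} {a : Zp p d → ZpDual p d → ℂ}
    (h : RegularSymbol p d m a) (N : ℕ) : ∃ C : ℝ, 0 ≤ C ∧ ∀ θ ξ,
      ‖fourier p d (fun x => a x ξ) θ‖ * jap p d θ ^ N ≤ C * jap p d ξ ^ m := by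
  obtain ⟨C₀, hC₀⟩ := h.bound
  obtain ⟨C₁, hC₁⟩ := h.trans N
  have hp : (0 : ℝ) < p := by exact_mod_cast (Fact.out : p.Prime).pos
  refine ⟨|C₀| + |C₁| * p ^ N, by positivity, fun θ ξ => ?_⟩
  have hj := jap_rpow_pos ξ m
  by_cases hθ : θ = 0
  · have : jap p d θ = 1 := by simp [hθ, jap]
    rw [this, one_pow, mul_one]
    refine (PadicPDO.norm_fourier_le (fun x => hC₀ x ξ) θ).trans ?_
    gcongr
    exact (le_abs_self _).trans (le_add_of_nonneg_right (by positivity))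
  · have h1 := norm_fourier_le_of_translate (h.cont ξ) (D := |C₁| * jap p d ξ ^ m) (by positivity)
      (N := N) (fun x y => (hC₁ x y ξ).trans (by
        rw [mul_right_comm]
        gcongr
        exact le_abs_self _)) hθ
    have hj2 := jap_pos θ
    rw [← jap_of_ne_zero hθ] at h1
    calc _ ≤ |C₁| * jap p d ξ ^ m * (p * (jap p d θ)⁻¹) ^ N * jap p d θ ^ N := by gcongr
      _ = |C₁| * p ^ N * jap p d ξ ^ m := by
          rw [mul_pow, inv_pow]; field_simp
      _ ≤ _ := by
          gcongr
          exact le_add_of_nonneg_left (by positivity)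

theorem RegularSymbol.summable_fourier {m : ℝ} {a : Zp p d → ZpDual p d → ℂ}
    (h : RegularSymbol p d m a) (ξ : ZpDual p d) :
    Summable fun θ => ‖fourier p d (fun x => a x ξ) θ‖ := by
  obtain ⟨C, -, hC⟩ := h.norm_fourier_le (2 * d)
  refine Summable.of_nonneg_of_le (fun _ => norm_nonneg _) (fun θ => ?_)
    ((summable_jap_inv (p := p) (d := d) le_rfl).mul_left (C * jap p d ξ ^ m))
  rw [← div_eq_mul_inv, le_div_iff₀ (pow_pos (jap_pos θ) _)]
  exact hC θ ξ

/-- The difference estimate decays in `ξ` but not in `ω`, the coefficient bound decays in `ω` but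
may grow in `ξ`. Their geometric mean decays in both. -/
theorem RegularSymbol.norm_fourier_diff_le {m : ℝ} {a : Zp p d → ZpDual p d → ℂ}
    (h : RegularSymbol p d m a) (N : ℕ) : ∃ (C : ℝ) (A : ℕ), 0 ≤ C ∧ ∀ ω ξ θ,
      ‖fourier p d (fun x => a x (ξ + θ)) ω - fourier p d (fun x => a x ξ) ω‖ *
        (jap p d ω ^ N * jap p d ξ ^ N) ≤ C * jap p d θ ^ A := by
  obtain ⟨M, hM⟩ := exists_nat_ge m
  obtain ⟨K, hK0, hK⟩ := h.norm_fourier_le (2 * N)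
  obtain ⟨D, A, hD⟩ := h.diff (2 * N + M)
  -- The summand `1` makes the constant at least `1`, so that it is below its square when the square
  -- root is taken. The exponent covers `M + A` for `‖θ‖ < ‖ξ‖` and `2M + N` otherwise.
  refine ⟨2 * K + 1 + 2 * K * |D|, 2 * M + N + A, by positivity, fun ω ξ θ => ?_⟩
  set δ := ‖fourier p d (fun x => a x (ξ + θ)) ω - fourier p d (fun x => a x ξ) ω‖ with hδ
  have hξ := one_le_jap ξ
  have hθ := one_le_jap θ
  have hω := one_le_jap ω
  have hY : δ * jap p d ω ^ (2 * N) ≤ 2 * K * jap p d ξ ^ M * jap p d θ ^ M := by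
    have e : ∀ ζ : ZpDual p d, jap p d ζ ≤ jap p d ξ * jap p d θ →
        ‖fourier p d (fun x => a x ζ) ω‖ * jap p d ω ^ (2 * N) ≤
          K * (jap p d ξ ^ M * jap p d θ ^ M) := fun ζ hζ => by
      refine (hK ω ζ).trans ?_
      have := jap_pos ζ
      rw [← mul_pow]
      gcongr
      exact (jap_rpow_le_pow hM ζ).trans (by gcongr)
    calc δ * jap p d ω ^ (2 * N) ≤ (‖fourier p d (fun x => a x (ξ + θ)) ω‖ +
          ‖fourier p d (fun x => a x ξ) ω‖) * jap p d ω ^ (2 * N) := by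
          gcongr; exact norm_sub_le _ _
      _ ≤ _ := by
          have e1 := e (ξ + θ) (jap_add_le_mul ξ θ)
          have e2 := e ξ (le_mul_of_one_le_right (by positivity) hθ)
          linarith
  have hA : ∀ B ≤ 2 * M + N + A, jap p d θ ^ B ≤ jap p d θ ^ (2 * M + N + A) := fun B hB =>
    pow_le_pow_right₀ hθ hB
  by_cases hlt : ‖θ‖ < ‖ξ‖
  · have hX : δ * jap p d ξ ^ (2 * N + M) ≤ |D| * jap p d θ ^ A := by
      have : δ ≤ |D| * jap p d θ ^ A * (jap p d ξ ^ (2 * N + M))⁻¹ := by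
        rw [hδ, ← fourier_sub (h.cont (ξ + θ)) (h.cont ξ)]
        refine PadicPDO.norm_fourier_le (fun x => ?_) ω
        rw [← div_eq_mul_inv, le_div_iff₀ (by positivity)]
        refine (hD x ξ θ hlt).trans ?_
        gcongr
        exact le_abs_self D
      rwa [← div_eq_mul_inv, le_div_iff₀ (by positivity)] at this
    have hsq : (δ * (jap p d ω ^ N * jap p d ξ ^ N)) ^ 2 ≤
        2 * K * |D| * jap p d θ ^ (M + A) := by
      have h1 : (δ * jap p d ω ^ (2 * N)) * (δ * jap p d ξ ^ (2 * N + M)) ≤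
          (2 * K * jap p d ξ ^ M * jap p d θ ^ M) * (|D| * jap p d θ ^ A) := by
        gcongr
      have h2 : jap p d ξ ^ M * (δ * (jap p d ω ^ N * jap p d ξ ^ N)) ^ 2 ≤
          jap p d ξ ^ M * (2 * K * |D| * jap p d θ ^ (M + A)) := by
        calc _ = (δ * jap p d ω ^ (2 * N)) * (δ * jap p d ξ ^ (2 * N + M)) := by ring
          _ ≤ _ := h1
          _ = _ := by ring
      exact le_of_mul_le_mul_left h2 (by positivity)
    have h3 : 2 * K * |D| * jap p d θ ^ (M + A) ≤
        ((2 * K + 1 + 2 * K * |D|) * jap p d θ ^ (2 * M + N + A)) ^ 2 := by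
      have h4 : 2 * K * |D| * jap p d θ ^ (M + A) ≤
          (2 * K + 1 + 2 * K * |D|) * jap p d θ ^ (2 * M + N + A) := by
        gcongr ?_ * ?_
        · linarith
        · exact hA _ (by omega)
      refine h4.trans (le_self_pow₀ ?_ two_ne_zero)
      have h5 : (1 : ℝ) ≤ 2 * K + 1 + 2 * K * |D| := by
        have : 0 ≤ 2 * K * |D| := by positivity
        linarith
      exact one_le_mul_of_one_le_of_one_le h5 (one_le_pow₀ hθ)
    exact le_of_sq_le_sq (hsq.trans h3) (by positivity)
  -- Outside the range of the difference estimate, every power of `⟨ξ⟩` is absorbed by the same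
  -- power of `⟨θ⟩`.
  · have hle : jap p d ξ ≤ jap p d θ := max_le_max le_rfl (not_lt.1 hlt)
    calc δ * (jap p d ω ^ N * jap p d ξ ^ N)
        ≤ δ * (jap p d ω ^ (2 * N) * jap p d θ ^ N) := by
          gcongr
          omega
      _ = δ * jap p d ω ^ (2 * N) * jap p d θ ^ N := by ring
      _ ≤ 2 * K * jap p d ξ ^ M * jap p d θ ^ M * jap p d θ ^ N := by gcongr
      _ ≤ 2 * K * jap p d θ ^ M * jap p d θ ^ M * jap p d θ ^ N := by gcongr
      _ = 2 * K * jap p d θ ^ (2 * M + N) := by ring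
      _ ≤ _ := by
          gcongr ?_ * ?_
          · have : 0 ≤ 2 * K * |D| := by positivity
            linarith
          · exact hA _ (by omega)

/-- Here `s` is the `ω`-th coefficient of the symbol of `T_a T_b` at `ξ`. The coefficient of `b a`
is the same convolution with `a` frozen at `ξ`, so only differences of `a` remain. -/
theorem RegularSymbol.norm_comp_sub_le {m m' : ℝ} {a b : Zp p d → ZpDual p d → ℂ}
    (ha : RegularSymbol p d m a) (hb : RegularSymbol p d m' b) (N : ℕ) :
    ∃ C : ℝ, 0 ≤ C ∧ ∀ (ω ξ : ZpDual p d) (s : ℂ),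
      HasSum (fun θ => fourier p d (fun x => b x ξ) θ *
        fourier p d (fun x => a x (ξ + θ)) (ω - θ)) s →
      ‖s - fourier p d (fun x => b x ξ * a x ξ) ω‖ * (jap p d ω ^ N * jap p d ξ ^ N) ≤ C := by
  obtain ⟨M, hM⟩ := exists_nat_ge m'
  obtain ⟨D, A, hD0, hD⟩ := ha.norm_fourier_diff_le (N + M)
  -- The decay of `b̂` in `θ` is spent on the cost `⟨θ⟩^A` of the differences, on `⟨ω⟩^N ≤ ⟨ω-θ⟩^N
  -- ⟨θ⟩^N`, and on summability. The extra `M` in `hD` cancels the growth of `b` in `ξ`.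
  obtain ⟨K, hK0, hK⟩ := hb.norm_fourier_le (A + N + 2 * d)
  refine ⟨K * D * ∑' θ : ZpDual p d, (jap p d θ ^ (2 * d))⁻¹, ?_, fun ω ξ s hs => ?_⟩
  · have : 0 ≤ ∑' θ : ZpDual p d, (jap p d θ ^ (2 * d))⁻¹ := tsum_nonneg fun θ => by
      have := jap_pos θ
      positivity
    positivity
  have h1 := hs.sub (fourier_mul (hb.cont ξ) (ha.cont ξ) (hb.summable_fourier ξ) ω)
  have hξ := one_le_jap ξ
  have hω := one_le_jap ω
  have h2 : HasSum (fun θ : ZpDual p d => K * D * (jap p d ω ^ N * jap p d ξ ^ N)⁻¹ *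
      (jap p d θ ^ (2 * d))⁻¹) (K * D * (jap p d ω ^ N * jap p d ξ ^ N)⁻¹ *
        ∑' θ : ZpDual p d, (jap p d θ ^ (2 * d))⁻¹) :=
    (summable_jap_inv le_rfl).hasSum.mul_left _
  have h3 := h1.norm_le_of_bounded h2 fun θ => ?_
  · calc _ ≤ K * D * (jap p d ω ^ N * jap p d ξ ^ N)⁻¹ *
        (∑' θ : ZpDual p d, (jap p d θ ^ (2 * d))⁻¹) * (jap p d ω ^ N * jap p d ξ ^ N) := by gcongr
      _ = _ := by field_simp
  · have hθ := one_le_jap θ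
    have hωθ := one_le_jap (ω - θ)
    rw [← mul_sub, norm_mul]
    have e1 := hD (ω - θ) ξ θ
    have e2 := (hK θ ξ).trans (mul_le_mul_of_nonneg_left (jap_rpow_le_pow hM ξ) hK0)
    set u := ‖fourier p d (fun x => b x ξ) θ‖
    set v := ‖fourier p d (fun x => a x (ξ + θ)) (ω - θ) - fourier p d (fun x => a x ξ) (ω - θ)‖
    have e3 : jap p d ω ≤ jap p d (ω - θ) * jap p d θ := by
      simpa using jap_add_le_mul (ω - θ) θ
    rw [mul_assoc (K * D), ← mul_inv, ← div_eq_mul_inv, le_div_iff₀ (by positivity)]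
    have e4 : (jap p d ξ ^ M * jap p d θ ^ A) * (u * v * (jap p d ω ^ N * jap p d ξ ^ N *
        jap p d θ ^ (2 * d))) ≤ (jap p d ξ ^ M * jap p d θ ^ A) * (K * D) := by
      calc _ ≤ (jap p d ξ ^ M * jap p d θ ^ A) * (u * v * ((jap p d (ω - θ) * jap p d θ) ^ N *
            jap p d ξ ^ N * jap p d θ ^ (2 * d))) := by gcongr
        _ = (u * jap p d θ ^ (A + N + 2 * d)) *
            (v * (jap p d (ω - θ) ^ N * jap p d ξ ^ (N + M))) := by ring
        _ ≤ (u * jap p d θ ^ (A + N + 2 * d)) *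
            (v * (jap p d (ω - θ) ^ (N + M) * jap p d ξ ^ (N + M))) := by
            gcongr
            omega
        _ ≤ (K * jap p d ξ ^ M) * (D * jap p d θ ^ A) := by gcongr
        _ = _ := by ring
    exact le_of_mul_le_mul_left e4 (by positivity)

end Symbols

/-! ### Bounded operators on `ℓ²` from matrices with decaying diagonals. -/

section MatrixOperators

variable {ι : Type*}

theorem summable_norm_sq_lp (c : lp (fun _ : ι => ℂ) 2) : Summable fun i => ‖c i‖ ^ 2 := by
  have h := (lp.memℓp c).summable (by norm_num)
  simpa using h

theorem tsum_norm_sq_lp (c : lp (fun _ : ι => ℂ) 2) : ∑' i, ‖c i‖ ^ 2 = ‖c‖ ^ 2 := by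
  have h := lp.norm_rpow_eq_tsum (p := 2) (by norm_num) c
  simpa using h.symm

theorem exists_weightedShift (e : ι ≃ ι) {a : ι → ℂ} {B : ℝ} (hB : 0 ≤ B) (ha : ∀ i, ‖a i‖ ≤ B) :
    ∃ W : lp (fun _ : ι => ℂ) 2 →L[ℂ] lp (fun _ : ι => ℂ) 2,
      ‖W‖ ≤ B ∧ ∀ c i, W c i = a i * c (e i) := by
  have hle : ∀ (c : lp (fun _ : ι => ℂ) 2) (i : ι), ‖a i * c (e i)‖ ^ 2 ≤ B ^ 2 * ‖c (e i)‖ ^ 2 :=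
    fun c i => by
      rw [norm_mul, mul_pow]
      gcongr
      exact ha i
  have hs : ∀ c : lp (fun _ : ι => ℂ) 2, Summable fun i => B ^ 2 * ‖c (e i)‖ ^ 2 := fun c =>
    ((e.summable_iff (f := fun i => ‖c i‖ ^ 2)).2 (summable_norm_sq_lp c)).mul_left _
  have hs2 : ∀ c : lp (fun _ : ι => ℂ) 2, Summable fun i => ‖a i * c (e i)‖ ^ 2 := fun c =>
    Summable.of_nonneg_of_le (fun _ => by positivity) (hle c) (hs c)
  have hmem : ∀ c : lp (fun _ : ι => ℂ) 2, Memℓp (fun i => a i * c (e i)) 2 := fun c => by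
    refine memℓp_gen ?_
    simpa using hs2 c
  let W : lp (fun _ : ι => ℂ) 2 →ₗ[ℂ] lp (fun _ : ι => ℂ) 2 :=
    { toFun := fun c => ⟨fun i => a i * c (e i), hmem c⟩
      map_add' := fun c c' => by
        apply lp.ext; funext i
        exact mul_add _ _ _
      map_smul' := fun z c => by
        apply lp.ext; funext i
        exact mul_left_comm _ _ _ }
  refine ⟨W.mkContinuous B fun c => ?_, LinearMap.mkContinuous_norm_le _ hB _, fun c i => rfl⟩
  refine lp.norm_le_of_tsum_le (by norm_num) (by positivity) ?_
  have h1 : ∑' i, ‖a i * c (e i)‖ ^ 2 ≤ (B * ‖c‖) ^ 2 := by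
    refine ((hs2 c).tsum_le_tsum (hle c) (hs c)).trans (le_of_eq ?_)
    rw [tsum_mul_left, e.tsum_eq (fun i => ‖c i‖ ^ 2), tsum_norm_sq_lp, mul_pow]
  simp only [ENNReal.toReal_ofNat, Real.rpow_ofNat]
  exact h1

/-- The matrix is split into its diagonals `i - j = t`. Each is a weighted shift of norm at most `w
t`, so the series of diagonals converges absolutely in operator norm. -/
theorem exists_matrixOperator [AddCommGroup ι] [DecidableEq ι] {K : ι → ι → ℂ} {w : ι → ℝ}
    (hw : Summable w) (hw0 : ∀ i, 0 ≤ w i) (hK : ∀ i j, ‖K i j‖ ≤ w (i - j)) :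
    ∃ T : lp (fun _ : ι => ℂ) 2 →L[ℂ] lp (fun _ : ι => ℂ) 2,
      ∀ i j (z : ℂ), T (lp.single 2 j z) i = K i j * z := by
  have h := fun t : ι => exists_weightedShift (Equiv.subRight t)
    (a := fun i => K i (i - t)) (hw0 t) (fun i => by
      have := hK i (i - t)
      rwa [sub_sub_cancel] at this)
  choose W hWn hW using h
  have hsum : Summable W := Summable.of_norm_bounded hw hWn
  refine ⟨∑' t, W t, fun i j z => ?_⟩
  have h1 : HasSum (fun t => W t (lp.single 2 j z) i) ((∑' t, W t) (lp.single 2 j z) i) := by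
    have := hsum.hasSum.mapL (ContinuousLinearMap.apply ℂ (lp (fun _ : ι => ℂ) 2) (lp.single 2 j z))
    exact this.mapL (lp.evalCLM ℂ (fun _ : ι => ℂ) 2 i)
  refine h1.unique ?_
  convert! hasSum_ite_eq (i - j) (K i j * z) using 2 with t
  rw [hW]
  split_ifs with ht
  · subst ht
    simp
  · have : i - t ≠ j := fun hc => ht (by rw [← hc, sub_sub_cancel])
    rw [lp.single_apply, Pi.single_eq_of_ne (by exact this), mul_zero]

end MatrixOperators

/-! ### Smoothing symbols from coefficients, and reduction to characters. -/

section Symbols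

variable {p : ℕ} [Fact p.Prime] {d : ℕ}

theorem norm_vladimirov_le {f : Zp p d → ℂ} {β : ℕ} {B : ℝ}
    (hB : ∀ θ, ‖fourier p d f θ‖ * jap p d θ ^ (β + 2 * d) ≤ B) (x : Zp p d) :
    ‖vladimirov p d β f x‖ ≤ B * ∑' θ : ZpDual p d, (jap p d θ ^ (2 * d))⁻¹ := by
  refine tsum_of_norm_bounded ((summable_jap_inv le_rfl).hasSum.mul_left B) fun θ => ?_
  have hj := jap_pos θ
  rw [norm_mul, norm_mul, norm_char, mul_one, Complex.norm_real, Real.norm_eq_abs,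
    abs_of_nonneg (by positivity), ← div_eq_mul_inv, le_div_iff₀ (by positivity)]
  refine le_trans ?_ (hB θ)
  calc ‖θ‖ ^ β * ‖fourier p d f θ‖ * jap p d θ ^ (2 * d)
      ≤ jap p d θ ^ β * ‖fourier p d f θ‖ * jap p d θ ^ (2 * d) := by
        gcongr; exact norm_le_jap θ
    _ = _ := by ring

theorem isSmooth_charSeries {c : ZpDual p d → ℂ}
    (hc : ∀ N : ℕ, ∃ C : ℝ, ∀ θ, ‖c θ‖ * jap p d θ ^ N ≤ C) :
    IsSmooth p d fun x => ∑' θ, c θ * char p d θ x := by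
  have hs : ∀ N : ℕ, Summable fun θ => jap p d θ ^ N * ‖c θ‖ := fun N => by
    obtain ⟨C, hC⟩ := hc (N + 2 * d)
    refine Summable.of_nonneg_of_le (fun θ => ?_) (fun θ => ?_)
      ((summable_jap_inv (p := p) (d := d) le_rfl).mul_left C)
    · have := jap_pos θ
      positivity
    · have := jap_pos θ
      rw [← div_eq_mul_inv, le_div_iff₀ (by positivity)]
      refine le_trans (le_of_eq ?_) (hC θ)
      ring
  have hs0 := summable_of_jap_pow_mul (hs 0)
  refine ⟨continuous_charSeries hs0, fun s => ?_⟩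
  obtain ⟨N, hN⟩ := exists_nat_ge s
  have h1 : Memℓp (besselCoeff p d s fun x => ∑' θ, c θ * char p d θ x) 1 := by
    refine memℓp_gen ?_
    simp only [ENNReal.toReal_one, Real.rpow_one]
    refine Summable.of_nonneg_of_le (fun _ => norm_nonneg _) (fun θ => ?_) (hs N)
    rw [besselCoeff, fourier_charSeries hs0, norm_mul, Complex.norm_real, Real.norm_eq_abs,
      abs_of_pos (jap_rpow_pos _ _)]
    gcongr
    exact jap_rpow_le_pow hN θ
  exact h1.of_exponent_ge one_le_two

/-- Decay in `θ` gives all `D^β`, decay in `ξ` gives every order `m`. The difference estimates cost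
only the triangle inequality, because `⟨ξ+η⟩ = ⟨ξ⟩` and `‖η‖ ^ α ≥ 1` for `η ≠ 0`. -/
theorem isSmoothingSymbol_charSeries {c : ZpDual p d → ZpDual p d → ℂ}
    (hc : ∀ N : ℕ, ∃ C : ℝ, 0 ≤ C ∧ ∀ θ ξ, ‖c θ ξ‖ * (jap p d θ ^ N * jap p d ξ ^ N) ≤ C) :
    IsSmoothingSymbol p d fun x ξ => ∑' θ, c θ ξ * char p d θ x := by
  intro m
  have hc1 : ∀ ξ, ∀ N : ℕ, ∃ C : ℝ, ∀ θ, ‖c θ ξ‖ * jap p d θ ^ N ≤ C := fun ξ N => by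
    obtain ⟨C, -, hC⟩ := hc N
    refine ⟨C, fun θ => le_trans ?_ (hC θ ξ)⟩
    have := jap_pos θ
    gcongr
    exact le_mul_of_one_le_right (by positivity) (one_le_pow₀ (one_le_jap ξ))
  have hsm := fun ξ => isSmooth_charSeries (hc1 ξ)
  have hF : ∀ ξ θ, fourier p d (fun x => ∑' θ, c θ ξ * char p d θ x) θ = c θ ξ := fun ξ θ => by
    obtain ⟨C, hC⟩ := hc1 ξ (2 * d)
    refine fourier_charSeries (c := fun θ => c θ ξ) (Summable.of_nonneg_of_le
      (fun _ => norm_nonneg _) (fun θ => ?_)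
      ((summable_jap_inv (p := p) (d := d) le_rfl).mul_left C)) θ
    rw [← div_eq_mul_inv, le_div_iff₀ (pow_pos (jap_pos θ) _)]
    exact hC θ
  obtain ⟨M, hM⟩ := exists_nat_ge (-m)
  have key : ∀ β : ℕ, ∃ C : ℝ, 0 ≤ C ∧ ∀ θ ξ,
      ‖c θ ξ‖ * jap p d θ ^ (β + 2 * d) ≤ C * jap p d ξ ^ m := fun β => by
    obtain ⟨C, hC0, hC⟩ := hc (β + 2 * d + M)
    refine ⟨C, hC0, fun θ ξ => ?_⟩
    have hθ := one_le_jap θ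
    have hξ := one_le_jap ξ
    have h1 : 1 ≤ jap p d ξ ^ m * jap p d ξ ^ (β + 2 * d + M) := by
      rw [← Real.rpow_natCast, ← Real.rpow_add (jap_pos ξ)]
      apply Real.one_le_rpow hξ
      push_cast
      have : (0 : ℝ) ≤ β + 2 * d := by positivity
      linarith
    have hj := jap_rpow_pos ξ m
    calc ‖c θ ξ‖ * jap p d θ ^ (β + 2 * d)
        ≤ ‖c θ ξ‖ * jap p d θ ^ (β + 2 * d + M) *
            (jap p d ξ ^ m * jap p d ξ ^ (β + 2 * d + M)) := by
          refine le_trans ?_ (le_mul_of_one_le_right (by positivity) h1)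
          exact mul_le_mul_of_nonneg_left (pow_le_pow_right₀ hθ (by omega)) (norm_nonneg _)
      _ = ‖c θ ξ‖ * (jap p d θ ^ (β + 2 * d + M) * jap p d ξ ^ (β + 2 * d + M)) *
            jap p d ξ ^ m := by ring
      _ ≤ _ := by
          gcongr
          exact hC θ ξ
  have hS : 0 ≤ ∑' θ : ZpDual p d, (jap p d θ ^ (2 * d))⁻¹ := tsum_nonneg fun θ => by
    have := jap_pos θ
    positivity
  set S := ∑' θ : ZpDual p d, (jap p d θ ^ (2 * d))⁻¹ with hSdef
  refine ⟨hsm, fun β => ?_, fun α β => ?_⟩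
  · obtain ⟨C, -, hC⟩ := key β
    refine ⟨C * S, fun x ξ => ?_⟩
    refine (norm_vladimirov_le (B := C * jap p d ξ ^ m) (fun θ => ?_) x).trans (le_of_eq ?_)
    · rw [hF]
      exact hC θ ξ
    · rw [zero_mul, add_zero]
      ring
  · obtain ⟨C, hC0, hC⟩ := key β
    refine ⟨2 * C * S, fun x ξ η hη => ?_⟩
    rw [zero_mul, zero_mul, sub_zero, add_zero]
    have hj := jap_rpow_pos ξ m
    rcases dual_eq_zero_or_lt η with h0 | h1
    · subst h0
      have : vladimirov p d β (fun y => (∑' θ, c θ (ξ + 0) * char p d θ y) -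
          ∑' θ, c θ ξ * char p d θ y) x = 0 := by
        simp [vladimirov, fourier]
      rw [this, norm_zero]
      positivity
    · have hle : ‖vladimirov p d β (fun y => (∑' θ, c θ (ξ + η) * char p d θ y) -
          ∑' θ, c θ ξ * char p d θ y) x‖ ≤ 2 * C * jap p d ξ ^ m * S := by
        refine norm_vladimirov_le (fun θ => ?_) x
        rw [fourier_sub (hsm (ξ + η)).1 (hsm ξ).1, hF, hF]
        have e1 := hC θ (ξ + η)
        have e2 := hC θ ξ
        rw [jap_add_eq hη] at e1
        have hθ := jap_pos θ
        calc _ ≤ (‖c θ (ξ + η)‖ + ‖c θ ξ‖) * jap p d θ ^ (β + 2 * d) := by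
              gcongr; exact norm_sub_le _ _
          _ ≤ _ := by linarith
      refine hle.trans ?_
      have h2 : 1 ≤ ‖η‖ ^ α := one_le_pow₀ h1.le
      calc 2 * C * jap p d ξ ^ m * S = 2 * C * S * 1 * jap p d ξ ^ m := by ring
        _ ≤ _ := by gcongr

theorem fourier_char (ξ η : ZpDual p d) : fourier p d (char p d ξ) η = if ξ = η then 1 else 0 :=
  integral_char_mul_conj ξ η

theorem hasSymbol_iff {E F : Type*} [AddCommGroup E] [Module ℂ E] [AddCommGroup F] [Module ℂ F]
    {ι : E →ₗ[ℂ] L2 p d} {κ : F →ₗ[ℂ] L2 p d} {A : E →ₗ[ℂ] F} {σ : Zp p d → ZpDual p d → ℂ}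
    (hι : Function.Injective ι) {e : ZpDual p d → E} (he : ∀ ξ, ι (e ξ) = charLp p d ξ) :
    HasSymbol p d ι κ A σ ↔
      ∀ ξ, κ (A (e ξ)) =ᵐ[haar p d] fun x => σ x ξ * char p d ξ x := by
  constructor
  · intro h ξ
    have h1 := h (e ξ) (char p d ξ) (Submodule.subset_span ⟨ξ, rfl⟩)
      (by rw [he]; exact coeFn_charLp ξ)
    refine h1.trans (Filter.Eventually.of_forall fun x => ?_)
    simp only [pseudoOp, fourier_char]
    rw [tsum_eq_single ξ]
    · simp
    · intro η hη
      simp [hη.symm]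
  · intro h f g hg hfg
    obtain ⟨c, rfl⟩ := Finsupp.mem_span_range_iff_exists_finsupp.1 hg
    have hgc : ∀ x, (c.sum fun i a => a • char p d i) x = ∑' θ, c θ * char p d θ x := fun x => by
      rw [tsum_eq_sum (s := c.support) fun θ hθ => by rw [Finsupp.notMem_support_iff.1 hθ, zero_mul]]
      simp [Finsupp.sum, Finset.sum_apply]
    have hcs : Summable fun θ => ‖c θ‖ :=
      summable_of_ne_finset_zero (s := c.support) fun θ hθ => by
        rw [Finsupp.notMem_support_iff.1 hθ, norm_zero]
    have hgf : ∀ θ, fourier p d (c.sum fun i a => a • char p d i) θ = c θ := fun θ => by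
      rw [funext hgc]
      exact fourier_charSeries hcs θ
    have hf : f = c.sum fun i a => a • e i := by
      apply hι
      rw [Finsupp.sum, map_sum]
      simp_rw [map_smul, he]
      apply Lp.ext
      refine hfg.trans ?_
      refine Filter.EventuallyEq.trans ?_ (Lp.coeFn_finsetSum _ _).symm
      have h1 : ∀ᵐ x ∂haar p d, ∀ i, (c i • charLp p d i : L2 p d) x = c i • char p d i x := by
        rw [ae_all_iff]
        intro i
        filter_upwards [Lp.coeFn_smul (c i) (charLp p d i), coeFn_charLp i] with x h1 h2
        rw [h1, Pi.smul_apply, h2]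
      filter_upwards [h1] with x hx
      simp [Finsupp.sum, Finset.sum_apply, hx]
    have hA : κ (A f) = ∑ i ∈ c.support, c i • κ (A (e i)) := by
      rw [hf, Finsupp.sum, map_sum, map_sum]
      simp_rw [map_smul]
    rw [hA]
    refine (Lp.coeFn_finsetSum _ _).trans ?_
    have h1 : ∀ᵐ x ∂haar p d, ∀ i, (c i • κ (A (e i)) : L2 p d) x =
        c i * (σ x i * char p d i x) := by
      rw [ae_all_iff]
      intro i
      filter_upwards [Lp.coeFn_smul (c i) (κ (A (e i))), h i] with x h1 h2
      rw [h1, Pi.smul_apply, h2, smul_eq_mul]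
    filter_upwards [h1] with x hx
    rw [pseudoOp, tsum_eq_sum (s := c.support)]
    · rw [Finset.sum_apply]
      refine Finset.sum_congr rfl fun i _ => ?_
      rw [hx, hgf]
      ring
    · intro θ hθ
      rw [hgf, Finsupp.notMem_support_iff.1 hθ]
      ring

theorem ae_eq_symbol_iff {a : Zp p d → ℂ} (ha : Continuous a) (g : L2 p d) (ξ : ZpDual p d) :
    g =ᵐ[haar p d] (fun x => a x * char p d ξ x) ↔
      ∀ ζ, fourier p d g ζ = fourier p d a (ζ - ξ) := by
  have hc : Continuous fun x => a x * char p d ξ x := ha.mul (continuous_char p d ξ)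
  constructor
  · intro h ζ
    rw [fourier_congr h, fourier_mul_char]
  · intro h
    have : g = ofContinuous hc := L2_ext fun ζ => by
      rw [h, fourier_congr (coeFn_ofContinuous hc), fourier_mul_char]
    rw [this]
    exact coeFn_ofContinuous hc

end Symbols

/-! ### Operators on Sobolev spaces and the parametrix. -/

section Operators

variable {p : ℕ} [Fact p.Prime] {d : ℕ}
variable {E : Type*} [SeminormedAddCommGroup E] [NormedSpace ℂ E]
variable {F : Type*} [SeminormedAddCommGroup F] [NormedSpace ℂ F]

/-- `E`, included into `L²(ℤ_p^d)` through `ι`, is identified through `J` with the Sobolev space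
of order `m`. -/
def IsSobolevModel (p : ℕ) [Fact p.Prime] (d : ℕ) (m : ℝ) (ι : E →ₗ[ℂ] L2 p d)
    (J : E ≃ₗᵢ[ℂ] lp (fun _ : ZpDual p d => ℂ) 2) : Prop :=
  ∀ f ξ, J f ξ = besselCoeff p d m (ι f) ξ

theorem isSobolevModel_L2 : IsSobolevModel p d 0 LinearMap.id (charBasis p d).repr := by
  intro f ξ
  rw [charBasis_repr, besselCoeff, Real.rpow_zero, Complex.ofReal_one, one_mul, LinearMap.id_apply]

theorem sobolevIncl_injective (s : ℝ) : Function.Injective (sobolevIncl p d s) :=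
  (sobolevSubmodule p d s).injective_subtype

theorem mul_besselCoeff (s : ℝ) (f : Zp p d → ℂ) (ξ : ZpDual p d) :
    ((jap p d ξ ^ (-s) : ℝ) : ℂ) * besselCoeff p d s f ξ = fourier p d f ξ := by
  rw [besselCoeff, ← mul_assoc, ← Complex.ofReal_mul, ← Real.rpow_add (jap_pos ξ), neg_add_cancel,
    Real.rpow_zero, Complex.ofReal_one, one_mul]

/-- Surjectivity needs `s ≥ 0`: multiplication by `⟨ξ⟩^(-s)` then maps `ℓ²` into itself, and the
preimage is an `L²` function. -/
theorem sobolevCoeff_bijective {s : ℝ} (hs : 0 ≤ s) : Function.Bijective (sobolevCoeff p d s) := by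
  constructor
  · intro f g hfg
    apply sobolevIncl_injective s
    refine L2_ext fun ξ => ?_
    have h : besselCoeff p d s (sobolevIncl p d s f) = besselCoeff p d s (sobolevIncl p d s g) :=
      congrArg Subtype.val hfg
    rw [← mul_besselCoeff s, ← mul_besselCoeff s, h]
  · intro c
    obtain ⟨W, -, hW⟩ := exists_weightedShift (Equiv.refl (ZpDual p d))
      (a := fun ξ => ((jap p d ξ ^ (-s) : ℝ) : ℂ)) zero_le_one fun ξ => by
        rw [Complex.norm_real, Real.norm_eq_abs, abs_of_pos (jap_rpow_pos _ _)]
        exact Real.rpow_le_one_of_one_le_of_nonpos (one_le_jap ξ) (by linarith)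
    set f : L2 p d := (charBasis p d).repr.symm (W c) with hf
    have h1 : besselCoeff p d s f = c := by
      funext ξ
      rw [besselCoeff, ← charBasis_repr, hf, LinearIsometryEquiv.apply_symm_apply, hW, ← mul_assoc,
        ← Complex.ofReal_mul, ← Real.rpow_add (jap_pos ξ), add_neg_cancel, Real.rpow_zero,
        Complex.ofReal_one, one_mul, Equiv.refl_apply]
    have hmem : f ∈ sobolevSubmodule p d s := by
      change Memℓp (besselCoeff p d s f) 2
      rw [h1]
      exact c.2
    exact ⟨(⟨f, hmem⟩ : sobolevSubmodule p d s), Subtype.ext h1⟩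

/-- The identification of the Sobolev space with `ℓ²`. -/
def sobolevEquiv {s : ℝ} (hs : 0 ≤ s) : Sobolev p d s ≃ₗᵢ[ℂ] lp (fun _ : ZpDual p d => ℂ) 2 where
  toLinearEquiv := LinearEquiv.ofBijective (sobolevCoeff p d s) (sobolevCoeff_bijective hs)
  norm_map' _ := rfl

theorem isSobolevModel_sobolev {s : ℝ} (hs : 0 ≤ s) :
    IsSobolevModel p d s (sobolevIncl p d s) (sobolevEquiv hs) := fun _ _ => rfl

namespace IsSobolevModel

variable {m m' : ℝ} {ι : E →ₗ[ℂ] L2 p d} {J : E ≃ₗᵢ[ℂ] lp (fun _ : ZpDual p d => ℂ) 2}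
  {ι' : F →ₗ[ℂ] L2 p d} {J' : F ≃ₗᵢ[ℂ] lp (fun _ : ZpDual p d => ℂ) 2}

/-- The character of `ξ` as an element of the Sobolev space. -/
def charVec (m : ℝ) (J : E ≃ₗᵢ[ℂ] lp (fun _ : ZpDual p d => ℂ) 2) (ξ : ZpDual p d) : E :=
  J.symm (lp.single 2 ξ ((jap p d ξ ^ m : ℝ) : ℂ))

theorem fourier_eq (h : IsSobolevModel p d m ι J) (f : E) (ξ : ZpDual p d) :
    fourier p d (ι f) ξ = ((jap p d ξ ^ (-m) : ℝ) : ℂ) * J f ξ := by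
  rw [h, mul_besselCoeff]

theorem apply_charVec (h : IsSobolevModel p d m ι J) (ξ : ZpDual p d) :
    ι (charVec m J ξ) = charLp p d ξ := by
  refine L2_ext fun η => ?_
  rw [h.fourier_eq, charVec, LinearIsometryEquiv.apply_symm_apply, fourier_charLp, lp.single_apply]
  split_ifs with hη
  · subst hη
    rw [Pi.single_eq_same, ← Complex.ofReal_mul, ← Real.rpow_add (jap_pos ξ), neg_add_cancel,
      Real.rpow_zero, Complex.ofReal_one]
  · rw [Pi.single_eq_of_ne (Ne.symm hη), mul_zero]

theorem injective (h : IsSobolevModel p d m ι J) : Function.Injective ι := by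
  intro f g hfg
  apply J.injective
  apply lp.ext
  funext ξ
  rw [h, h, hfg]

theorem norm_le (h : IsSobolevModel p d m ι J) (hm : 0 ≤ m) (f : E) : ‖ι f‖ ≤ ‖f‖ := by
  rw [← (charBasis p d).repr.norm_map, ← J.norm_map]
  refine lp.norm_mono two_ne_zero fun ξ => ?_
  rw [charBasis_repr, h, besselCoeff, norm_mul, Complex.norm_real, Real.norm_eq_abs,
    abs_of_pos (jap_rpow_pos _ _)]
  exact le_mul_of_one_le_left (norm_nonneg _) (Real.one_le_rpow (one_le_jap ξ) hm)

theorem single_eq (z : ℂ) (ξ : ZpDual p d) : (lp.single 2 ξ z : lp (fun _ : ZpDual p d => ℂ) 2) =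
    (((jap p d ξ ^ (-m) : ℝ) : ℂ) * z) • lp.single 2 ξ ((jap p d ξ ^ m : ℝ) : ℂ) := by
  rw [← lp.single_smul, smul_eq_mul, mul_right_comm, ← Complex.ofReal_mul,
    ← Real.rpow_add (jap_pos ξ), neg_add_cancel, Real.rpow_zero, Complex.ofReal_one, one_mul]

theorem hasSum_charVec (h : IsSobolevModel p d m ι J) (f : E) :
    HasSum (fun η => fourier p d (ι f) η • charVec m J η) f := by
  have h1 := (lp.hasSum_single (p := 2) ENNReal.ofNat_ne_top (J f)).mapL
    (J.symm.toContinuousLinearEquiv : lp (fun _ : ZpDual p d => ℂ) 2 →L[ℂ] E)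
  simp only [ContinuousLinearEquiv.coe_coe, LinearIsometryEquiv.coe_toContinuousLinearEquiv,
    LinearIsometryEquiv.symm_apply_apply] at h1
  convert! h1 using 2 with η
  rw [single_eq (m := m), map_smul, h.fourier_eq, charVec]

theorem clm_ext (h : IsSobolevModel p d m ι J) {G : Type*} [NormedAddCommGroup G] [NormedSpace ℂ G]
    {S T : E →L[ℂ] G} (hST : ∀ ξ, S (charVec m J ξ) = T (charVec m J ξ)) : S = T := by
  ext f
  have h1 := (h.hasSum_charVec f).mapL S
  have h2 := (h.hasSum_charVec f).mapL T
  simp only [map_smul, hST] at h1 h2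
  exact h1.unique h2

/-- `A` acts on characters as the pseudo-differential operator with symbol `a`. -/
def ActsAs (m : ℝ) (J : E ≃ₗᵢ[ℂ] lp (fun _ : ZpDual p d => ℂ) 2)
    (ι' : F →ₗ[ℂ] L2 p d) (A : E →ₗ[ℂ] F) (a : Zp p d → ZpDual p d → ℂ) : Prop :=
  ∀ ξ ζ, fourier p d (ι' (A (charVec m J ξ))) ζ = fourier p d (fun x => a x ξ) (ζ - ξ)

theorem hasSymbol_iff_actsAs (h : IsSobolevModel p d m ι J) {a : Zp p d → ZpDual p d → ℂ}
    (ha : ∀ ξ, Continuous fun x => a x ξ) (A : E →ₗ[ℂ] F) :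
    HasSymbol p d ι ι' A a ↔ ActsAs m J ι' A a := by
  rw [hasSymbol_iff h.injective h.apply_charVec]
  exact forall_congr' fun ξ => ae_eq_symbol_iff (ha ξ) _ ξ

/-- In the weighted bases the matrix is `⟨ζ⟩^m' â(ζ-ξ,ξ) ⟨ξ⟩^(-m)`. Moving `⟨ζ⟩^m'` to `⟨ζ-ξ⟩^m'
⟨ξ⟩^m'` cancels all powers of `⟨ξ⟩` and leaves a summable function of `ζ - ξ`. -/
theorem exists_actsAs (m : ℝ) (J : E ≃ₗᵢ[ℂ] lp (fun _ : ZpDual p d => ℂ) 2)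
    (h' : IsSobolevModel p d m' ι' J') (hm' : 0 ≤ m') {a : Zp p d → ZpDual p d → ℂ} (ha : RegularSymbol p d (m - m') a) :
    ∃ A : E →L[ℂ] F, ActsAs m J ι' (A : E →ₗ[ℂ] F) a := by
  obtain ⟨M, hM⟩ := exists_nat_ge m'
  obtain ⟨C, hC0, hC⟩ := ha.norm_fourier_le (M + 2 * d)
  obtain ⟨T, hT⟩ := exists_matrixOperator (ι := ZpDual p d)
    (K := fun ζ ξ => ((jap p d ζ ^ m' : ℝ) : ℂ) * fourier p d (fun x => a x ξ) (ζ - ξ) *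
      ((jap p d ξ ^ (-m) : ℝ) : ℂ))
    (w := fun θ => C * (jap p d θ ^ (2 * d))⁻¹) ((summable_jap_inv le_rfl).mul_left C)
    (fun θ => by have := jap_pos θ; positivity) fun ζ ξ => by
      rw [norm_mul, norm_mul, Complex.norm_real, Complex.norm_real, Real.norm_eq_abs,
        Real.norm_eq_abs, abs_of_pos (jap_rpow_pos _ _), abs_of_pos (jap_rpow_pos _ _)]
      have hθ := jap_pos (ζ - ξ)
      have hξ := jap_pos ξ
      have h1 : jap p d ζ ^ m' ≤ jap p d (ζ - ξ) ^ M * jap p d ξ ^ m' := by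
        have e := jap_add_le_mul (ζ - ξ) ξ
        rw [sub_add_cancel] at e
        calc jap p d ζ ^ m' ≤ (jap p d (ζ - ξ) * jap p d ξ) ^ m' :=
              Real.rpow_le_rpow (jap_pos ζ).le e hm'
          _ = jap p d (ζ - ξ) ^ m' * jap p d ξ ^ m' := Real.mul_rpow hθ.le hξ.le
          _ ≤ _ := by
              have := jap_rpow_pos ξ m'
              gcongr
              exact jap_rpow_le_pow hM _
      have hj := jap_rpow_pos ξ m'
      have hj2 := jap_rpow_pos ξ (-m)
      rw [← div_eq_mul_inv C, le_div_iff₀ (by positivity)]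
      calc _ ≤ jap p d (ζ - ξ) ^ M * jap p d ξ ^ m' * ‖fourier p d (fun x => a x ξ) (ζ - ξ)‖ *
            jap p d ξ ^ (-m) * jap p d (ζ - ξ) ^ (2 * d) := by gcongr
        _ = ‖fourier p d (fun x => a x ξ) (ζ - ξ)‖ * jap p d (ζ - ξ) ^ (M + 2 * d) *
            (jap p d ξ ^ m' * jap p d ξ ^ (-m)) := by ring
        _ ≤ C * jap p d ξ ^ (m - m') * (jap p d ξ ^ m' * jap p d ξ ^ (-m)) := by
            exact mul_le_mul_of_nonneg_right (hC _ _) (by positivity)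
        _ = C := by
            rw [mul_assoc, ← Real.rpow_add hξ, ← Real.rpow_add hξ,
              show m - m' + (m' + -m) = 0 by ring, Real.rpow_zero, mul_one]
  refine ⟨((J'.symm.toContinuousLinearEquiv : lp (fun _ : ZpDual p d => ℂ) 2 →L[ℂ] F) ∘L T) ∘L
    (J.toContinuousLinearEquiv : E →L[ℂ] lp (fun _ : ZpDual p d => ℂ) 2), fun ξ ζ => ?_⟩
  have e : ∀ (q : ZpDual p d) (s : ℝ),
      ((jap p d q ^ (-s) : ℝ) : ℂ) * ((jap p d q ^ s : ℝ) : ℂ) = 1 := fun q s => by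
    rw [← Complex.ofReal_mul, ← Real.rpow_add (jap_pos q), neg_add_cancel, Real.rpow_zero,
      Complex.ofReal_one]
  rw [h'.fourier_eq]
  change _ * J' (J'.symm (T (J (charVec m J ξ)))) ζ = _
  rw [LinearIsometryEquiv.apply_symm_apply, charVec, LinearIsometryEquiv.apply_symm_apply, hT]
  linear_combination fourier p d (fun x => a x ξ) (ζ - ξ) * e ζ m' +
    fourier p d (fun x => a x ξ) (ζ - ξ) * ((jap p d ζ ^ (-m') : ℝ) : ℂ) *
      ((jap p d ζ ^ m' : ℝ) : ℂ) * e ξ m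

/-- The symbol at `ξ` is read off from the image of the character `χ_ξ`, its frequencies shifted by
`-ξ`. -/
theorem isSmoothing_of_rapid_decay (h : IsSobolevModel p d m ι J) (R : E →ₗ[ℂ] E)
    (hR : ∀ N : ℕ, ∃ C : ℝ, 0 ≤ C ∧ ∀ ω ξ,
      ‖fourier p d (ι (R (charVec m J ξ))) (ξ + ω)‖ * (jap p d ω ^ N * jap p d ξ ^ N) ≤ C) :
    IsSmoothing p d ι R := by
  have hr := isSmoothingSymbol_charSeries
    (c := fun ω ξ => fourier p d (ι (R (charVec m J ξ))) (ξ + ω)) hR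
  refine ⟨_, hr, (h.hasSymbol_iff_actsAs (fun ξ => ((hr 0).smooth ξ).1) R).2 fun ξ ζ => ?_⟩
  rw [fourier_charSeries (c := fun ω => fourier p d (ι (R (charVec m J ξ))) (ξ + ω)),
    add_sub_cancel]
  obtain ⟨C, hC0, hC⟩ := hR (2 * d)
  refine Summable.of_nonneg_of_le (fun _ => norm_nonneg _) (fun θ => ?_)
    ((summable_jap_inv (p := p) (d := d) le_rfl).mul_left C)
  rw [← div_eq_mul_inv, le_div_iff₀ (pow_pos (jap_pos θ) _)]
  refine le_trans ?_ (hC θ ξ)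
  have := jap_pos θ
  gcongr
  exact le_mul_of_one_le_right (by positivity) (one_le_pow₀ (one_le_jap ξ))

/-- The Fourier coefficient at `ζ` as a continuous functional on the Sobolev space. -/
theorem exists_fourier_clm (h : IsSobolevModel p d m ι J) (ζ : ZpDual p d) :
    ∃ φ : E →L[ℂ] ℂ, ∀ f, φ f = fourier p d (ι f) ζ :=
  ⟨((jap p d ζ ^ (-m) : ℝ) : ℂ) • (lp.evalCLM ℂ (fun _ : ZpDual p d => ℂ) 2 ζ ∘L
    (J.toContinuousLinearEquiv : E →L[ℂ] lp (fun _ : ZpDual p d => ℂ) 2)), fun f => by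
    rw [h.fourier_eq]
    rfl⟩

/-- Stated for two Sobolev models so that it serves both orders of composition of operator and
parametrix. -/
theorem isSmoothing_comp_sub_id (h : IsSobolevModel p d m ι J) (h' : IsSobolevModel p d m' ι' J')
    {r r' : ℝ} {a b : Zp p d → ZpDual p d → ℂ} (ha : RegularSymbol p d r a)
    (hb : RegularSymbol p d r' b) {B : E →L[ℂ] F} {A : F →L[ℂ] E}
    (hB : ActsAs m J ι' (B : E →ₗ[ℂ] F) b) (hA : ActsAs m' J' ι (A : F →ₗ[ℂ] E) a) {n : ℕ}
    (hba : ∀ x ξ, b x ξ * a x ξ = if (n : ℝ) ≤ ‖ξ‖ then 1 else 0) :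
    IsSmoothing p d ι ((A : F →ₗ[ℂ] E) ∘ₗ (B : E →ₗ[ℂ] F) - LinearMap.id) := by
  refine h.isSmoothing_of_rapid_decay _ fun N => ?_
  obtain ⟨C, hC0, hC⟩ := ha.norm_comp_sub_le hb N
  refine ⟨C + max 1 (n : ℝ) ^ N, by positivity, fun ω ξ => ?_⟩
  have hs : HasSum (fun θ => fourier p d (fun x => b x ξ) θ *
      fourier p d (fun x => a x (ξ + θ)) (ω - θ))
      (fourier p d (ι (A (B (charVec m J ξ)))) (ξ + ω)) := by
    obtain ⟨φ, hφ⟩ := h.exists_fourier_clm (ξ + ω)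
    have h1 := (h'.hasSum_charVec (B (charVec m J ξ))).mapL (φ ∘L A)
    simp only [map_smul, ContinuousLinearMap.comp_apply, hφ] at h1
    rw [← (Equiv.addLeft ξ).hasSum_iff] at h1
    convert! h1 using 2 with θ
    simp only [Function.comp, Equiv.coe_addLeft, smul_eq_mul]
    have e1 := hB ξ (ξ + θ)
    have e2 := hA (ξ + θ) (ξ + ω)
    rw [add_sub_cancel_left] at e1
    rw [add_sub_add_left_eq_sub] at e2
    exact (congrArg₂ (· * ·) e1 e2).symm
  have h2 := hC ω ξ _ hs
  have hone : fourier p d (fun x => b x ξ * a x ξ) ω =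
      if (n : ℝ) ≤ ‖ξ‖ then (if ω = 0 then 1 else 0) else 0 := by
    simp_rw [hba]
    split_ifs with h1 h3
    · subst h3
      simp [fourier, char_zero]
    · have := fourier_char 0 ω
      simp_rw [funext (char_zero (p := p) (d := d)), if_neg (Ne.symm h3)] at this
      exact this
    · simp [fourier]
  have hid : fourier p d (ι (charVec m J ξ)) (ξ + ω) = if ω = 0 then 1 else 0 := by
    rw [h.apply_charVec, fourier_charLp]
    simp only [left_eq_add]
  have hsub : fourier p d (ι (((A : F →ₗ[ℂ] E) ∘ₗ (B : E →ₗ[ℂ] F) - LinearMap.id :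
      E →ₗ[ℂ] E) (charVec m J ξ))) (ξ + ω) = fourier p d (ι (A (B (charVec m J ξ)))) (ξ + ω) -
        fourier p d (ι (charVec m J ξ)) (ξ + ω) := by
    obtain ⟨φ, hφ⟩ := h.exists_fourier_clm (ξ + ω)
    rw [← hφ, ← hφ, ← hφ, ← map_sub]
    rfl
  rw [hsub, hid]
  rw [hone] at h2
  have hξ := one_le_jap ξ
  have hω := one_le_jap ω
  by_cases hn : (n : ℝ) ≤ ‖ξ‖
  · rw [if_pos hn] at h2
    exact h2.trans (le_add_of_nonneg_right (by positivity))
  · rw [if_neg hn, sub_zero] at h2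
    -- Below the cutoff the product symbol is `0` and not `1`. The defect sits at `ω = 0` and `‖ξ‖ <
    -- n`, where every weight is bounded.
    have h3 : ‖(if ω = 0 then 1 else 0 : ℂ)‖ * (jap p d ω ^ N * jap p d ξ ^ N) ≤
        max 1 (n : ℝ) ^ N := by
      split_ifs with h0
      · have : jap p d ω = 1 := by simp [h0, jap]
        rw [this, norm_one, one_pow, one_mul, one_mul]
        gcongr
        exact max_le_max le_rfl (not_le.1 hn).le
      · rw [norm_zero, zero_mul]
        positivity
    calc _ ≤ (‖fourier p d (ι (A (B (charVec m J ξ)))) (ξ + ω)‖ +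
          ‖(if ω = 0 then 1 else 0 : ℂ)‖) * (jap p d ω ^ N * jap p d ξ ^ N) := by
          gcongr; exact norm_sub_le _ _
      _ ≤ _ := by
          rw [add_mul]
          exact add_le_add h2 h3

theorem existsUnique_hasSymbol (h : IsSobolevModel p d m ι J) {a : Zp p d → ZpDual p d → ℂ}
    (ha : RegularSymbol p d m a) :
    ∃! T : E →L[ℂ] L2 p d, HasSymbol p d ι LinearMap.id T.toLinearMap a := by
  obtain ⟨T, hT⟩ := exists_actsAs m J isSobolevModel_L2 le_rfl (a := a) (by rwa [sub_zero])
  refine ⟨T, (h.hasSymbol_iff_actsAs ha.cont _).2 hT, fun S hS => ?_⟩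
  have hS := (h.hasSymbol_iff_actsAs ha.cont _).1 hS
  refine h.clm_ext fun ξ => L2_ext fun ζ => ?_
  exact (hS ξ ζ).trans (hT ξ ζ).symm

theorem sub_smul_hasSymbol (h : IsSobolevModel p d m ι J) {a : Zp p d → ZpDual p d → ℂ}
    {A : E →ₗ[ℂ] L2 p d} (hA : HasSymbol p d ι LinearMap.id A a) (l : ℂ) :
    HasSymbol p d ι LinearMap.id (A - l • ι) fun x ξ => a x ξ - l := by
  rw [hasSymbol_iff h.injective h.apply_charVec] at hA ⊢
  intro ξ
  have e : (LinearMap.id : L2 p d →ₗ[ℂ] L2 p d) ((A - l • ι) (charVec m J ξ)) =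
      A (charVec m J ξ) - l • charLp p d ξ := by
    simp [h.apply_charVec]
  rw [e]
  filter_upwards [Lp.coeFn_sub (A (charVec m J ξ)) (l • charLp p d ξ),
    Lp.coeFn_smul l (charLp p d ξ), coeFn_charLp ξ, hA ξ] with x h1 h2 h3 h4
  rw [LinearMap.id_apply] at h4
  rw [h1, Pi.sub_apply, h2, Pi.smul_apply, h3, h4, smul_eq_mul, sub_mul]

theorem notMem_fredholmSpectrum (h : IsSobolevModel p d m ι J) (hm : 0 ≤ m)
    {a : Zp p d → ZpDual p d → ℂ} (ha : RegularSymbol p d m a) {T : E →L[ℂ] L2 p d}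
    (hT : HasSymbol p d ι LinearMap.id T.toLinearMap a) {l : ℂ} {c : ℝ} (hc : 0 < c) {n : ℕ}
    (hell : ∀ x ξ, (n : ℝ) ≤ ‖ξ‖ → c * jap p d ξ ^ m ≤ ‖a x ξ - l‖) :
    l ∉ fredholmSpectrum p d ι T := by
  have ha' := ha.sub_const hm l
  have hb := ha'.cutInv hm hc hell
  have hinv : ∀ x ξ, (a x ξ - l) * cutInv p d n (fun x ξ => a x ξ - l) x ξ =
      if (n : ℝ) ≤ ‖ξ‖ then 1 else 0 := fun x ξ => by
    simp only [cutInv]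
    split_ifs with hξ
    · refine mul_inv_cancel₀ (norm_pos_iff.1 ((mul_pos hc (jap_rpow_pos ξ m)).trans_le ?_))
      exact hell x ξ hξ
    · exact mul_zero _
  let A : E →L[ℂ] L2 p d := T - l • ι.mkContinuous 1 fun f => by
    rw [one_mul]; exact h.norm_le hm f
  have hAe : (A : E →ₗ[ℂ] L2 p d) = (T : E →ₗ[ℂ] L2 p d) - l • ι := rfl
  have hA : ActsAs m J LinearMap.id (A : E →ₗ[ℂ] L2 p d) fun x ξ => a x ξ - l := by
    rw [← h.hasSymbol_iff_actsAs ha'.cont, hAe]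
    exact h.sub_smul_hasSymbol hT l
  obtain ⟨S, hS⟩ := exists_actsAs 0 (charBasis p d).repr h hm
    (a := cutInv p d n fun x ξ => a x ξ - l) (by rwa [zero_sub])
  rw [fredholmSpectrum, Set.notMem_compl_iff]
  refine ⟨S, ?_, ?_⟩
  · rw [← hAe]
    exact h.isSmoothing_comp_sub_id isSobolevModel_L2 hb ha' hA hS hinv
  · rw [← hAe]
    exact isSobolevModel_L2.isSmoothing_comp_sub_id h ha' hb hS hA fun x ξ => by
      rw [mul_comm]; exact hinv x ξ

end IsSobolevModel

end Operators

/-! ### Limit values of an order-zero symbol lie in the Fredholm spectrum. -/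

section Necessity

variable {p : ℕ} [Fact p.Prime] {d : ℕ}

/-- The frequencies with `‖θ‖ ≤ p ^ k` form a finite group. Translating by one that is nontrivial at
`y` shows that the sum vanishes, so this Dirichlet kernel is supported exactly in a ball. -/
theorem sum_char_eq_zero_or {k : ℕ} {s : Finset (ZpDual p d)}
    (hs : ∀ θ, θ ∈ s ↔ ‖θ‖ ≤ (p : ℝ) ^ k) (y : Zp p d) :
    ∑ θ ∈ s, char p d θ y = 0 ∨ ‖y‖ ≤ ((p : ℝ) ^ k)⁻¹ := by
  by_cases h : ∃ θ ∈ s, char p d θ y ≠ 1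
  · obtain ⟨θ, hθ, hne⟩ := h
    left
    have hmem : ∀ η, η ∈ s ↔ Equiv.addRight θ η ∈ s := fun η => by
      rw [hs] at hθ
      rw [Equiv.coe_addRight, hs, hs]
      refine ⟨fun hη => (dual_norm_add_le η θ).trans (max_le hη hθ), fun hη => ?_⟩
      have := dual_norm_add_le (η + θ) (-θ)
      rw [add_neg_cancel_right, norm_neg] at this
      exact this.trans (max_le hη hθ)
    have h1 : ∑ η ∈ s, char p d η y * char p d θ y = ∑ η ∈ s, char p d η y :=
      Finset.sum_equiv (Equiv.addRight θ) hmem fun η _ => (char_add η θ y).symm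
    rw [← Finset.sum_mul] at h1
    have h2 : (∑ η ∈ s, char p d η y) * (char p d θ y - 1) = 0 := by
      rw [mul_sub, h1, mul_one, sub_self]
    exact (mul_eq_zero.1 h2).resolve_right (sub_ne_zero.2 hne)
  · push Not at h
    exact Or.inr (norm_le_of_char_eq_one fun θ hθ => h θ ((hs θ).2 hθ))

theorem norm_toLp_le {f : C(Zp p d, ℂ)} {B : ℝ} (hB : 0 ≤ B) (h : ∀ x, ‖f x‖ ≤ B) :
    ‖(ContinuousMap.toLp 2 (haar p d) ℂ f : L2 p d)‖ ≤ B := by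
  have h1 := Lp.norm_le_of_ae_bound (f := (ContinuousMap.toLp 2 (haar p d) ℂ f : L2 p d)) hB (by
    filter_upwards [ContinuousMap.coeFn_toLp (p := 2) (𝕜 := ℂ) (haar p d) f] with x hx
    rw [hx]
    exact h x)
  simpa [measureUnivNNReal] using h1

theorem norm_fourier_le_norm (f : L2 p d) (ξ : ZpDual p d) : ‖fourier p d f ξ‖ ≤ ‖f‖ := by
  rw [← charBasis_repr, ← (charBasis p d).repr.norm_map]
  exact lp.norm_apply_le_norm two_ne_zero _ _

theorem HasSymbol.apply_toLp {A : L2 p d →ₗ[ℂ] L2 p d} {a : Zp p d → ZpDual p d → ℂ}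
    (hA : HasSymbol p d LinearMap.id LinearMap.id A a) {aC : ZpDual p d → C(Zp p d, ℂ)}
    (haC : ∀ x ξ, aC ξ x = a x ξ) (s : Finset (ZpDual p d)) (c : ZpDual p d → ℂ)
    (g : ZpDual p d → ZpDual p d) :
    A (ContinuousMap.toLp 2 (haar p d) ℂ (∑ η ∈ s, c η • charMap p d (g η))) =
      ContinuousMap.toLp 2 (haar p d) ℂ (∑ η ∈ s, c η • (aC (g η) * charMap p d (g η))) := by
  have h1 := (hasSymbol_iff (e := charLp p d) (fun _ _ h => h) fun ξ => rfl).1 hA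
  have h2 : ∀ ξ, A (charLp p d ξ) =
      ContinuousMap.toLp 2 (haar p d) ℂ (aC ξ * charMap p d ξ) := fun ξ => by
    apply Lp.ext
    refine (h1 ξ).trans ((ContinuousMap.coeFn_toLp (haar p d) _).trans ?_).symm
    refine Filter.Eventually.of_forall fun x => ?_
    rw [ContinuousMap.mul_apply, haC]
    rfl
  rw [map_sum, map_sum, map_sum]
  refine Finset.sum_congr rfl fun η _ => ?_
  rw [map_smul, map_smul, map_smul, ← h2]
  rfl

theorem mem_fredholmSpectrum_of_mem {a : Zp p d → ZpDual p d → ℂ} (ha : RegularSymbol p d 0 a)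
    {T : L2 p d →L[ℂ] L2 p d} (hT : HasSymbol p d LinearMap.id LinearMap.id T.toLinearMap a)
    {l : ℂ} (hl : ∀ ε > 0, ∀ n : ℕ, ∃ x ξ, (n : ℝ) ≤ ‖ξ‖ ∧ ‖a x ξ - l‖ < ε) :
    l ∈ fredholmSpectrum p d LinearMap.id T := by
  rintro ⟨S, ⟨r, hr, hrs⟩, -⟩
  have hb := ha.sub_const le_rfl l
  have hB := isSobolevModel_L2.sub_smul_hasSymbol hT l
  set b : Zp p d → ZpDual p d → ℂ := fun x ξ => a x ξ - l with hbdef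
  set B : L2 p d →ₗ[ℂ] L2 p d := T.toLinearMap - l • LinearMap.id with hBdef
  have hp : (1 : ℝ) < p := by exact_mod_cast (Fact.out : p.Prime).one_lt
  -- Chosen against the final estimate `‖u‖ ≤ (2‖S‖ + 1) ε ‖u‖`, which is then impossible.
  set ε : ℝ := 1 / (2 * ‖S‖ + 2) with hε
  have hε0 : 0 < ε := by positivity
  obtain ⟨C₁, hC₁⟩ := hb.trans 1
  obtain ⟨C₂, A, hC₂⟩ := hb.diff 1
  obtain ⟨C₃, hC₃⟩ := (hr (-1)).norm_le
  obtain ⟨k, hk⟩ : ∃ k : ℕ, |C₁| * ((p : ℝ) ^ k)⁻¹ < ε / 2 := by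
    have ht : Filter.Tendsto (fun k : ℕ => |C₁| * ((p : ℝ) ^ k)⁻¹) Filter.atTop (nhds (|C₁| * 0)) :=
      (tendsto_pow_atTop_atTop_of_one_lt hp).inv_tendsto_atTop.const_mul _
    rw [mul_zero] at ht
    exact (ht.eventually (gt_mem_nhds (by positivity))).exists
  have hp1 : 1 ≤ (p : ℝ) ^ k := one_le_pow₀ hp.le
  set s : Finset (ZpDual p d) := (finite_norm_le ((p : ℝ) ^ k)).toFinset with hsdef
  have hs : ∀ θ, θ ∈ s ↔ ‖θ‖ ≤ (p : ℝ) ^ k := fun θ => by simp [hsdef]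
  set Q : ℝ := s.card * (|C₂| * ((p : ℝ) ^ k) ^ A + |C₃|) with hQ
  -- The radius `p ^ (-k)`, and with it the number of frequencies in the packet, is fixed before
  -- `ξ`. Then `‖ξ‖ ≥ n > p ^ k` puts all shifts `η` in the range of the difference estimates, and
  -- `⟨ξ⟩ ≥ Q / ε` beats their number.
  obtain ⟨n, hn⟩ := exists_nat_gt (max ((p : ℝ) ^ k) (Q / ε))
  rw [max_lt_iff] at hn
  obtain ⟨x₀, ξ, hξ, hx₀⟩ := hl (ε / 2) (by positivity) n
  have hjξ : Q / ε ≤ jap p d ξ := hn.2.le.trans (hξ.trans (norm_le_jap ξ))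
  have hj := jap_pos ξ
  have hQle : Q * (jap p d ξ)⁻¹ ≤ ε := by
    rw [div_le_iff₀ hε0] at hjξ
    rw [← div_eq_mul_inv, div_le_iff₀ hj]
    linarith
  have hlt : ∀ θ ∈ s, ‖θ‖ < ‖ξ‖ := fun θ hθ => ((hs θ).1 hθ).trans_lt (hn.1.trans_le hξ)
  have hjs : ∀ θ ∈ s, jap p d θ ≤ (p : ℝ) ^ k := fun θ hθ => max_le hp1 ((hs θ).1 hθ)
  set c : ZpDual p d → ℂ := fun η => starRingEnd ℂ (char p d η x₀) with hc
  have hcn : ∀ η, ‖c η‖ = 1 := fun η => by rw [hc, RCLike.norm_conj, norm_char]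
  set bC : ZpDual p d → C(Zp p d, ℂ) := fun η => ⟨fun x => b x η, hb.cont η⟩ with hbC
  set rC : ZpDual p d → C(Zp p d, ℂ) := fun η => ⟨fun x => r x η, ((hr 0).smooth η).1⟩ with hrC
  set U : C(Zp p d, ℂ) := ∑ η ∈ s, c η • charMap p d (ξ + η) with hU
  set u : L2 p d := ContinuousMap.toLp 2 (haar p d) ℂ U with hu
  have hUx : ∀ x, U x = char p d ξ x * ∑ η ∈ s, char p d η (x - x₀) := fun x => by
    rw [hU, ContinuousMap.sum_apply, Finset.mul_sum]
    refine Finset.sum_congr rfl fun η _ => ?_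
    have e : char p d η (x - x₀) = char p d η x * c η := by
      have h1 := char_apply_add η (x - x₀) x₀
      rw [sub_add_cancel] at h1
      have h2 : char p d η x₀ * c η = 1 := by
        rw [hc, Complex.mul_conj, Complex.normSq_eq_norm_sq, norm_char]; norm_num
      rw [h1, mul_assoc, h2, mul_one]
    rw [ContinuousMap.smul_apply, smul_eq_mul, e]
    change c η * char p d (ξ + η) x = _
    rw [char_add]
    ring
  have hbU : ∀ x, ‖(bC ξ * U) x‖ ≤ ε * ‖U x‖ := fun x => by
    rw [ContinuousMap.mul_apply, norm_mul]
    rcases sum_char_eq_zero_or hs (x - x₀) with h0 | h1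
    · rw [hUx, h0, mul_zero, norm_zero, mul_zero, mul_zero]
    · gcongr
      have h2 := hC₁ x₀ (x - x₀) ξ
      rw [add_sub_cancel, Real.rpow_zero, mul_one, pow_one] at h2
      calc ‖b x ξ‖ = ‖(b x ξ - b x₀ ξ) + b x₀ ξ‖ := by rw [sub_add_cancel]
        _ ≤ ‖b x ξ - b x₀ ξ‖ + ‖b x₀ ξ‖ := norm_add_le _ _
        _ ≤ |C₁| * ((p : ℝ) ^ k)⁻¹ + ε / 2 := by
            refine add_le_add (h2.trans ?_) hx₀.le
            exact mul_le_mul (le_abs_self _) h1 (norm_nonneg _) (abs_nonneg _)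
        _ ≤ ε := by linarith
  -- The coefficient of `u` at `ξ` comes from `η = 0` alone and has modulus `1`.
  have hnorm : 1 ≤ ‖u‖ := by
    refine le_trans (le_of_eq ?_) (norm_fourier_le_norm u ξ)
    obtain ⟨φ, hφ⟩ := isSobolevModel_L2.exists_fourier_clm (p := p) (d := d) ξ
    have h1 : φ u = ∑ η ∈ s, c η * fourier p d (charLp p d (ξ + η)) ξ := by
      rw [hu, hU, map_sum, map_sum]
      refine Finset.sum_congr rfl fun η _ => ?_
      rw [map_smul, map_smul, smul_eq_mul]
      exact congrArg (c η * ·) (hφ (charLp p d (ξ + η)))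
    have h2 := hφ u
    rw [LinearMap.id_apply] at h2
    rw [← h2, h1, Finset.sum_eq_single 0]
    · rw [norm_mul, hcn, fourier_charLp, add_zero, if_pos rfl, norm_one, mul_one]
    · intro η _ hη
      rw [fourier_charLp, if_neg (by simpa using hη), mul_zero]
    · intro h0
      exact absurd ((hs 0).2 (by rw [norm_zero]; positivity)) h0
  -- One `ε` comes from freezing the symbol at `ξ`, where it is small on the support of the packet,
  -- the other from the differences between `ξ + η` and `ξ`.
  have hBu : ‖B u‖ ≤ 2 * ε * ‖u‖ := by
    have h1 : ∑ η ∈ s, c η • (bC (ξ + η) * charMap p d (ξ + η)) =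
        bC ξ * U + ∑ η ∈ s, c η • ((bC (ξ + η) - bC ξ) * charMap p d (ξ + η)) := by
      rw [hU, Finset.mul_sum, ← Finset.sum_add_distrib]
      refine Finset.sum_congr rfl fun η _ => ?_
      rw [mul_smul_comm, ← smul_add, sub_mul, add_sub_cancel]
    rw [hu, hB.apply_toLp (aC := bC) (fun _ _ => rfl), h1, map_add]
    have h2 : ‖(ContinuousMap.toLp 2 (haar p d) ℂ (bC ξ * U) : L2 p d)‖ ≤ ε * ‖u‖ := by
      refine Lp.norm_le_mul_norm_of_ae_le_mul ?_
      filter_upwards [ContinuousMap.coeFn_toLp (p := 2) (𝕜 := ℂ) (haar p d) (bC ξ * U),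
        ContinuousMap.coeFn_toLp (p := 2) (𝕜 := ℂ) (haar p d) U] with x h1 h2
      rw [h1, h2]
      exact hbU x
    have h3 : ‖(ContinuousMap.toLp 2 (haar p d) ℂ
        (∑ η ∈ s, c η • ((bC (ξ + η) - bC ξ) * charMap p d (ξ + η))) : L2 p d)‖ ≤ ε := by
      refine norm_toLp_le hε0.le fun x => ?_
      rw [ContinuousMap.sum_apply]
      refine (norm_sum_le_of_le s (n := fun η => |C₂| * ((p : ℝ) ^ k) ^ A * (jap p d ξ)⁻¹)
        fun η hη => ?_).trans ?_
      · rw [ContinuousMap.smul_apply, norm_smul, hcn, one_mul, ContinuousMap.mul_apply, norm_mul]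
        change ‖b x (ξ + η) - b x ξ‖ * ‖char p d (ξ + η) x‖ ≤ _
        rw [norm_char, mul_one, ← div_eq_mul_inv, le_div_iff₀ hj]
        have h4 := hC₂ x ξ η (hlt η hη)
        rw [pow_one] at h4
        refine h4.trans ?_
        have := jap_pos η
        gcongr
        · exact le_abs_self _
        · exact hjs η hη
      · rw [Finset.sum_const, nsmul_eq_mul, ← mul_assoc]
        refine le_trans ?_ hQle
        gcongr
        rw [hQ]
        exact mul_le_mul_of_nonneg_left (le_add_of_nonneg_right (abs_nonneg _)) (Nat.cast_nonneg _)
    calc _ ≤ ε * ‖u‖ + ε := (norm_add_le _ _).trans (add_le_add h2 h3)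
      _ ≤ _ := by nlinarith
  set R : L2 p d →ₗ[ℂ] L2 p d := (S : L2 p d →ₗ[ℂ] L2 p d) ∘ₗ B - LinearMap.id with hR
  have hRu : ‖R u‖ ≤ ε := by
    rw [hu, HasSymbol.apply_toLp (A := R) hrs (aC := rC) (fun _ _ => rfl)]
    refine norm_toLp_le hε0.le fun x => ?_
    rw [ContinuousMap.sum_apply]
    refine (norm_sum_le_of_le s (n := fun η => |C₃| * (jap p d ξ)⁻¹) fun η hη => ?_).trans ?_
    · rw [ContinuousMap.smul_apply, norm_smul, hcn, one_mul, ContinuousMap.mul_apply, norm_mul]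
      change ‖r x (ξ + η)‖ * ‖char p d (ξ + η) x‖ ≤ _
      have h4 := hC₃ x (ξ + η)
      rw [jap_add_eq (hlt η hη), Real.rpow_neg_one] at h4
      rw [norm_char, mul_one]
      refine h4.trans ?_
      gcongr
      exact le_abs_self _
    · rw [Finset.sum_const, nsmul_eq_mul, ← mul_assoc]
      refine le_trans ?_ hQle
      gcongr
      rw [hQ]
      exact mul_le_mul_of_nonneg_left (le_add_of_nonneg_left (by positivity)) (Nat.cast_nonneg _)
  have hfin : ‖u‖ ≤ ‖S‖ * (2 * ε * ‖u‖) + ε * ‖u‖ := by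
    have e : u = S (B u) - R u := by
      have : R u = S (B u) - u := rfl
      rw [this, sub_sub_cancel]
    calc ‖u‖ = ‖S (B u) - R u‖ := by rw [← e]
      _ ≤ ‖S (B u)‖ + ‖R u‖ := norm_sub_le _ _
      _ ≤ ‖S‖ * (2 * ε * ‖u‖) + ε * ‖u‖ :=
          add_le_add (S.le_opNorm_of_le hBu) (hRu.trans (le_mul_of_one_le_right hε0.le hnorm))
  have h5 : ε * (2 * ‖S‖ + 2) = 1 := by
    rw [hε]; field_simp
  nlinarith [norm_nonneg S]

end Necessity

/-! ### The two spectral formulas. -/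

section Main

variable {p : ℕ} [Fact p.Prime] {d : ℕ}

theorem mem_closure_values_iff {a : Zp p d → ZpDual p d → ℂ} {l : ℂ} {n : ℕ} :
    l ∈ closure (⋃ (ξ : ZpDual p d) (_ : (n : ℝ) ≤ ‖ξ‖), Set.range fun x => a x ξ) ↔
      ∀ ε > 0, ∃ x ξ, (n : ℝ) ≤ ‖ξ‖ ∧ ‖a x ξ - l‖ < ε := by
  rw [Metric.mem_closure_iff]
  refine forall₂_congr fun ε _ => ?_
  constructor
  · rintro ⟨b, hb, hlb⟩
    simp only [Set.mem_iUnion, Set.mem_range] at hb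
    obtain ⟨ξ, hξ, x, rfl⟩ := hb
    exact ⟨x, ξ, hξ, by rwa [dist_comm, dist_eq_norm] at hlb⟩
  · rintro ⟨x, ξ, hξ, h⟩
    refine ⟨a x ξ, ?_, by rwa [dist_comm, dist_eq_norm]⟩
    simp only [Set.mem_iUnion, Set.mem_range]
    exact ⟨ξ, hξ, x, rfl⟩

theorem fredholmSpectrum_eq_of_order_zero {a : Zp p d → ZpDual p d → ℂ}
    (ha : RegularSymbol p d 0 a) {T : L2 p d →L[ℂ] L2 p d}
    (hT : HasSymbol p d LinearMap.id LinearMap.id T.toLinearMap a) :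
    fredholmSpectrum p d LinearMap.id T = ⋂ n : ℕ, closure (⋃ (ξ : ZpDual p d)
      (_ : (n : ℝ) ≤ ‖ξ‖), Set.range fun x => a x ξ) := by
  ext l
  simp only [Set.mem_iInter, mem_closure_values_iff]
  refine ⟨fun hl n ε hε => ?_, fun hl => mem_fredholmSpectrum_of_mem ha hT fun ε hε n => hl n ε hε⟩
  by_contra! hc
  refine isSobolevModel_L2.notMem_fredholmSpectrum le_rfl ha hT hε (n := n) (fun x ξ hξ => ?_) hl
  rw [Real.rpow_zero, mul_one]
  exact hc x ξ hξ

theorem IsElliptic.exists_le_norm_sub {m : ℝ} (hm : 0 < m) {a : Zp p d → ZpDual p d → ℂ}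
    (ha : IsElliptic p d m a) (l : ℂ) : ∃ c > 0, ∃ n : ℕ, ∀ x ξ, (n : ℝ) ≤ ‖ξ‖ →
      c * jap p d ξ ^ m ≤ ‖a x ξ - l‖ := by
  obtain ⟨c, hc, n, h⟩ := ha
  obtain ⟨N, hN⟩ := Filter.eventually_atTop.1
    ((tendsto_rpow_atTop hm).eventually_ge_atTop (2 * ‖l‖ / c))
  obtain ⟨k, hk⟩ := exists_nat_ge N
  refine ⟨c / 2, by positivity, max n k, fun x ξ hξ => ?_⟩
  rw [Nat.cast_max, max_le_iff] at hξ
  have h1 := h x ξ hξ.1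
  have h2 := hN (jap p d ξ) (hk.trans (hξ.2.trans (norm_le_jap ξ)))
  rw [div_le_iff₀ hc] at h2
  have h3 := norm_sub_norm_le (a x ξ) l
  linarith

/-- Both sides are empty: for every `l` the symbol `a - l` is still elliptic of order `m`, so a
parametrix exists and the values at large `ξ` stay away from `l`. -/
theorem fredholmSpectrum_eq_of_elliptic {m : ℝ} (hm : 0 < m) {a : Zp p d → ZpDual p d → ℂ}
    (ha : RegularSymbol p d m a) (hell : IsElliptic p d m a) {T : Sobolev p d m →L[ℂ] L2 p d}
    (hT : HasSymbol p d (sobolevIncl p d m) LinearMap.id T.toLinearMap a) :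
    fredholmSpectrum p d (sobolevIncl p d m) T = ⋂ n : ℕ, closure (⋃ (ξ : ZpDual p d)
      (_ : (n : ℝ) ≤ ‖ξ‖), Set.range fun x => a x ξ) := by
  ext l
  obtain ⟨c, hc, n, h⟩ := hell.exists_le_norm_sub hm l
  refine iff_of_false
    ((isSobolevModel_sobolev hm.le).notMem_fredholmSpectrum hm.le ha hT hc h) fun hl => ?_
  simp only [Set.mem_iInter, mem_closure_values_iff] at hl
  obtain ⟨x, ξ, hξ, hlt⟩ := hl n c hc
  exact absurd ((le_mul_of_one_le_right hc.le (Real.one_le_rpow (one_le_jap ξ) hm.le)).trans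
    (h x ξ hξ)) (not_le.2 hlt)

end Main

end PadicPDO

end

theorem mainTheorem1 (p : ℕ) [Fact p.Prime] (d : ℕ) (ρ : ℝ) (hρ0 : 0 < ρ) (hρ1 : ρ ≤ 1) :
    (∀ σ : PadicPDO.Zp p d → PadicPDO.ZpDual p d → ℂ, PadicPDO.IsSymbol p d 0 ρ 0 σ →
      (∃! T : PadicPDO.L2 p d →L[ℂ] PadicPDO.L2 p d,
        PadicPDO.HasSymbol p d LinearMap.id LinearMap.id T.toLinearMap σ) ∧
      ∀ T : PadicPDO.L2 p d →L[ℂ] PadicPDO.L2 p d,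
        PadicPDO.HasSymbol p d LinearMap.id LinearMap.id T.toLinearMap σ →
        PadicPDO.fredholmSpectrum p d LinearMap.id T =
          ⋂ n : ℕ, closure (⋃ (ξ : PadicPDO.ZpDual p d) (_ : (n : ℝ) ≤ ‖ξ‖),
            Set.range fun x => σ x ξ)) ∧
    (∀ m : ℝ, 0 < m → ∀ σ : PadicPDO.Zp p d → PadicPDO.ZpDual p d → ℂ,
      PadicPDO.IsSymbol p d m ρ 0 σ → PadicPDO.IsElliptic p d m σ →
      (∃! T : PadicPDO.Sobolev p d m →L[ℂ] PadicPDO.L2 p d,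
        PadicPDO.HasSymbol p d (PadicPDO.sobolevIncl p d m) LinearMap.id T.toLinearMap σ) ∧
      ∀ T : PadicPDO.Sobolev p d m →L[ℂ] PadicPDO.L2 p d,
        PadicPDO.HasSymbol p d (PadicPDO.sobolevIncl p d m) LinearMap.id T.toLinearMap σ →
        PadicPDO.fredholmSpectrum p d (PadicPDO.sobolevIncl p d m) T =
          ⋂ n : ℕ, closure (⋃ (ξ : PadicPDO.ZpDual p d) (_ : (n : ℝ) ≤ ‖ξ‖),
            Set.range fun x => σ x ξ)) := by
  refine ⟨fun σ hσ => ?_, fun m hm σ hσ hell => ?_⟩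
  · have ha := hσ.regularSymbol hρ0
    exact ⟨PadicPDO.isSobolevModel_L2.existsUnique_hasSymbol ha,
      fun T hT => PadicPDO.fredholmSpectrum_eq_of_order_zero ha hT⟩
  · have ha := hσ.regularSymbol hρ0
    exact ⟨(PadicPDO.isSobolevModel_sobolev hm.le).existsUnique_hasSymbol ha,
      fun T hT => PadicPDO.fredholmSpectrum_eq_of_elliptic hm ha hell hT⟩
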